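/- Let $A\in\mathbb C^{n\times n}$ be Schur stable (all eigenvalues of modulus less than $1$), let $B\in\mathbb C^{n\times m}$ have full column rank $m\le n$, let the pair $(A,B)$ be reachable (the matrix $[B,AB,\dots,A^{n-1}B]$ has rank $n$), and put $G(z)=(zI-A)^{-1}B$ for $z$ in the unit circle $\mathbb T$. Write $\int F=\int_{-\pi}^{\pi}F(e^{i\theta})\,\frac{d\theta}{2\pi}$, let $\mathfrak H_k$ be the real vector space of Hermitian $k\times k$ matrices, and let $$\Gamma\colon C(\mathbb T;\mathfrak H_m)\to\mathfrak H_n,\qquad \Phi\mapsto\int G\Phi G^*,$$ with range $\mathrm{im}\,\Gamma$, a real linear subspace of $\mathfrak H_n$. Let $$\mathscr L_+^\Gamma=\{\Lambda\in\mathrm{im}\,\Gamma : G^*(z)\Lambda G(z)>0\ \ \forall z\in\mathbb T\},\qquad \mathrm{im}_+\Gamma=\{\Sigma\in\mathrm{im}\,\Gamma : \Sigma>0\}.$$ Let $\psi\colon\mathbb T\to\mathbb R$ be continuous and coercive, i.e. $\psi\ge c$ on $\mathbb T$ for some constant $c>0$ (this corresponds to the scalar prior $\Psi=\psi I_m$),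 and define $$\tilde\omega(\Lambda)=\int\psi\,G(G^*\Lambda G)^{-1}G^*,\qquad \Lambda\in\mathscr L_+^\Gamma.$$ Then: 1. $\tilde\omega$ is differentiable on $\mathscr L_+^\Gamma$ as a map into $\mathrm{im}\,\Gamma$, and its Jacobian determinant (the determinant of the differential, an endomorphism of $\mathrm{im}\,\Gamma$) vanishes nowhere in $\mathscr L_+^\Gamma$. 2. $\mathscr L_+^\Gamma$ and $\mathrm{im}_+\Gamma$ are open in $\mathrm{im}\,\Gamma$, and $\tilde\omega$ is a $C^1$ diffeomorphism from $\mathscr L_+^\Gamma$ onto $\mathrm{im}_+\Gamma$. 3. Consequently the parametric spectral estimation problem with prior $\psi I_m$ is well-posed: for every $\Sigma\in\mathrm{im}_+\Gamma$ there is exactly one $\Lambda\in\mathscr L_+^\Gamma$ with $\tilde\omega(\Lambda)=\Sigma$, and there is exactly one $\Phi$ in the family $\{\psi(G^*\Lambda G)^{-1}:\Lambda\in\mathscr L_+^\Gamma\}$ with $\int G\Phi G^*=\Sigma$; both $\Lambda$ and $\Phi$ (the latter in the uniform norm on $C(\mathbb T;\mathfrak H_m)$) depend continuously on $\Sigma\in\mathrm{im}_+\Gamma$.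 -/

import Mathlib

open scoped Matrix ComplexOrder

noncomputable section

namespace SpectralEstimation

/-- The type of `k × k` complex Hermitian matrices. -/
def HermMat (k : ℕ) : Type :=
  ↥(selfAdjoint.submodule ℝ (Matrix (Fin k) (Fin k) ℂ))

namespace HermMat

variable {k : ℕ}

/-- Hermitian matrices carry the Frobenius norm. -/
instance : NormedAddCommGroup (HermMat k) :=
  letI : NormedAddCommGroup (Matrix (Fin k) (Fin k) ℂ) := Matrix.frobeniusNormedAddCommGroup
  inferInstanceAs (NormedAddCommGroup ↥(selfAdjoint.submodule ℝ (Matrix (Fin k) (Fin k) ℂ)))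

/-- Hermitian matrices form a real vector space. -/
instance : NormedSpace ℝ (HermMat k) :=
  letI : NormedAddCommGroup (Matrix (Fin k) (Fin k) ℂ) := Matrix.frobeniusNormedAddCommGroup
  letI : NormedSpace ℝ (Matrix (Fin k) (Fin k) ℂ) := Matrix.frobeniusNormedSpace
  inferInstanceAs (NormedSpace ℝ ↥(selfAdjoint.submodule ℝ (Matrix (Fin k) (Fin k) ℂ)))

/-- The inclusion of the Hermitian matrices into all complex matrices. -/
def toMat : HermMat k →ₗ[ℝ] Matrix (Fin k) (Fin k) ℂ :=
  (selfAdjoint.submodule ℝ (Matrix (Fin k) (Fin k) ℂ)).subtype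

/-- A Hermitian matrix as an element of `HermMat k`. -/
def ofMat (M : Matrix (Fin k) (Fin k) ℂ) (hM : M.IsHermitian) : HermMat k := ⟨M, hM⟩

@[simp] theorem toMat_ofMat (M : Matrix (Fin k) (Fin k) ℂ) (hM : M.IsHermitian) :
    (ofMat M hM).toMat = M := rfl

theorem toMat_injective : Function.Injective (toMat (k := k)) := Subtype.val_injective

theorem isHermitian_toMat (X : HermMat k) : X.toMat.IsHermitian := X.2

theorem continuous_toMat : Continuous (toMat (k := k)) := continuous_subtype_val

theorem continuous_ofMat {T : Type*} [TopologicalSpace T] {f : T → Matrix (Fin k) (Fin k) ℂ}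
    (hf : Continuous f) (h : ∀ t, (f t).IsHermitian) : Continuous fun t => ofMat (f t) (h t) :=
  hf.subtype_mk h

theorem norm_eq (X : HermMat k) : ‖X‖ = Real.sqrt (∑ i, ∑ j, ‖X.toMat i j‖ ^ 2) := by
  refine (Matrix.frobenius_norm_def X.toMat).trans ?_
  rw [Real.sqrt_eq_rpow]
  norm_num

instance : FiniteDimensional ℝ (HermMat k) :=
  inferInstanceAs
    (FiniteDimensional ℝ ↥(selfAdjoint.submodule ℝ (Matrix (Fin k) (Fin k) ℂ)))

end HermMat

/-- The data `(A, B)` of the filter bank `x(t+1) = A x(t) + B y(t)`: `A` is Schur stable, `B` has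
full column rank (which forces `m ≤ n`), and `(A, B)` is reachable, that is, the reachability matrix
`[B, AB, …, A^(n-1) B]` has rank `n`. -/
structure FilterBank (n m : ℕ) where
  A : Matrix (Fin n) (Fin n) ℂ
  B : Matrix (Fin n) (Fin m) ℂ
  schurStable : ∀ μ ∈ spectrum ℂ A, ‖μ‖ < 1
  fullColumnRank : B.rank = m
  reachable :
    (Matrix.of fun (i : Fin n) (p : Fin n × Fin m) => (A ^ (p.1 : ℕ) * B) i p.2).rank = n

namespace FilterBank

variable {n m : ℕ} (S : FilterBank n m)

/-- The transfer function `G(z) = (zI - A)⁻¹ B` on the unit circle. -/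
def G (z : Circle) : Matrix (Fin n) (Fin m) ℂ :=
  ((z : ℂ) • (1 : Matrix (Fin n) (Fin n) ℂ) - S.A)⁻¹ * S.B

theorem det_ne_zero (z : Circle) :
    ((z : ℂ) • (1 : Matrix (Fin n) (Fin n) ℂ) - S.A).det ≠ 0 := by
  intro h
  have hz : (z : ℂ) ∈ spectrum ℂ S.A := by
    rw [spectrum.mem_iff, Algebra.algebraMap_eq_smul_one, Matrix.isUnit_iff_isUnit_det, h]
    simp
  have := S.schurStable _ hz
  exact absurd z.norm_coe this.ne

theorem continuous_G : Continuous S.G := by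
  have h1 : Continuous fun z : Circle =>
      (z : ℂ) • (1 : Matrix (Fin n) (Fin n) ℂ) - S.A :=
    ((continuous_subtype_val (p := fun x : ℂ => x ∈ Submonoid.unitSphere ℂ)).smul continuous_const).sub continuous_const
  have h2 : Continuous fun z : Circle =>
      ((z : ℂ) • (1 : Matrix (Fin n) (Fin n) ℂ) - S.A)⁻¹ := by
    simp only [Matrix.inv_def, Ring.inverse_eq_inv']
    exact (h1.matrix_det.inv₀ S.det_ne_zero).smul h1.matrix_adjugate
  exact h2.matrix_mul continuous_const

/-- The integrand `G Φ G*` of the moment map, as a continuous function on the circle. -/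
def momentIntegrand (Φ : C(Circle, HermMat m)) : C(Circle, HermMat n) where
  toFun z := HermMat.ofMat (S.G z * (Φ z).toMat * (S.G z)ᴴ)
    (Matrix.isHermitian_mul_mul_conjTranspose (S.G z) (Φ z).isHermitian_toMat)
  continuous_toFun := HermMat.continuous_ofMat
    ((S.continuous_G.matrix_mul (HermMat.continuous_toMat.comp Φ.continuous)).matrix_mul
      S.continuous_G.matrix_conjTranspose) _

/-- The integral of a function on the unit circle against the normalized Lebesgue measure. -/
def circleMean {E : Type*} [NormedAddCommGroup E] [NormedSpace ℝ E] (F : Circle → E) : E :=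
  (2 * Real.pi)⁻¹ • ∫ θ in (-Real.pi)..Real.pi, F (Circle.exp θ)

/-- The linear operator `Γ : C(𝕋; H_m) → H_n`, `Φ ↦ ∫ G Φ G*`. -/
def Gam : C(Circle, HermMat m) →ₗ[ℝ] HermMat n where
  toFun Φ := circleMean fun z => S.momentIntegrand Φ z
  map_add' Φ Ψ := by
    have hi (Φ : C(Circle, HermMat m)) : IntervalIntegrable
        (fun θ => S.momentIntegrand Φ (Circle.exp θ)) MeasureTheory.volume (-Real.pi) Real.pi :=
      ((S.momentIntegrand Φ).continuous.comp Circle.exp.continuous).intervalIntegrable _ _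
    have h : ∀ z, S.momentIntegrand (Φ + Ψ) z =
        S.momentIntegrand Φ z + S.momentIntegrand Ψ z := fun z => by
      apply HermMat.toMat_injective
      simp [momentIntegrand, Matrix.mul_add, Matrix.add_mul]
    simp only [circleMean, h]
    rw [intervalIntegral.integral_add (hi Φ) (hi Ψ), smul_add]
  map_smul' c Φ := by
    have h : ∀ z, S.momentIntegrand (c • Φ) z = c • S.momentIntegrand Φ z := fun z => by
      apply HermMat.toMat_injective
      simp [momentIntegrand]
    simp only [circleMean, h, RingHom.id_apply]
    rw [intervalIntegral.integral_smul, smul_comm]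

/-- The range `im Γ`, a real subspace of the space of Hermitian matrices. -/
abbrev imGam : Submodule ℝ (HermMat n) := LinearMap.range S.Gam

/-- `𝓛₊`: the Hermitian `Λ` with `G*(z) Λ G(z) > 0` for all `z` on the unit circle. -/
def Lplus : Set (HermMat n) :=
  {Λ | ∀ z : Circle, ((S.G z)ᴴ * Λ.toMat * S.G z).PosDef}

/-- `𝓛₊^Γ = 𝓛₊ ∩ im Γ`, as a subset of the real vector space `im Γ`. -/
def LplusGam : Set S.imGam := {Λ | (Λ : HermMat n) ∈ S.Lplus}

/-- `im₊ Γ`: the positive definite elements of `im Γ`, as a subset of `im Γ`. -/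
def imPlusGam : Set S.imGam :=
  {C | (C : HermMat n).toMat.PosDef}

/-- The spectral density `Φ_Λ = ψ (G* Λ G)⁻¹` with scalar prior `ψ`, for `Λ ∈ 𝓛₊`. -/
def density (ψ : C(Circle, ℝ)) (Λ : S.Lplus) : C(Circle, HermMat m) where
  toFun z := ψ z • HermMat.ofMat ((S.G z)ᴴ * Λ.1.toMat * S.G z)⁻¹ (Λ.2 z).isHermitian.inv
  continuous_toFun := by
    refine ψ.continuous.smul (HermMat.continuous_ofMat ?_ _)
    have h1 : Continuous fun z : Circle =>
        (S.G z)ᴴ * Λ.1.toMat * S.G z :=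
      (S.continuous_G.matrix_conjTranspose.matrix_mul continuous_const).matrix_mul S.continuous_G
    simp only [Matrix.inv_def, Ring.inverse_eq_inv']
    exact (h1.matrix_det.inv₀ fun z => (Λ.2 z).det_pos.ne').smul h1.matrix_adjugate

/-- The parametric family `{ψ (G* Λ G)⁻¹ : Λ ∈ 𝓛₊^Γ}` of spectral densities. -/
def family (ψ : C(Circle, ℝ)) : Set C(Circle, HermMat m) :=
  {Φ | ∃ (Λ : S.imGam) (hΛ : Λ ∈ S.LplusGam), Φ = S.density ψ ⟨Λ, hΛ⟩}

open scoped Classical in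
/-- The map `Λ ↦ ∫ ψ G (G* Λ G)⁻¹ G*` on `𝓛₊^Γ`, with values in `im Γ`. It is extended by `0`
outside the open set `𝓛₊^Γ`, so that the derivative of a map `im Γ → im Γ` makes sense. -/
def omegaTilde (ψ : C(Circle, ℝ)) (Λ : S.imGam) : S.imGam :=
  if hΛ : Λ ∈ S.LplusGam then S.Gam.rangeRestrict (S.density ψ ⟨Λ, hΛ⟩) else 0

end FilterBank

/-- `f` restricts to a `C¹` diffeomorphism from the open set `U` onto the open set `V`. -/
def IsC1Diffeo {E : Type*} [NormedAddCommGroup E] [NormedSpace ℝ E]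
    (f : E → E) (U V : Set E) : Prop :=
  IsOpen U ∧ IsOpen V ∧ Set.BijOn f U V ∧ ContDiffOn ℝ 1 f U ∧
    ∃ g : E → E, Set.InvOn g f U V ∧ ContDiffOn ℝ 1 g V

end SpectralEstimation

end

/-! Write `Q = G* Λ G` and use the trace pairing on Hermitian matrices. The adjoint of `Γ` is `Λ ↦
G* Λ G`, so `ω̃` is the gradient of the concave functional `∫ ψ log det Q`. Its differential sends
`H` to `-∫ ψ G Q⁻¹ (G* H G) Q⁻¹ G*`; pairing with `H` gives minus the integral of a nonnegative
trace, which vanishes only if `G* H G = 0`, hence only if `H = 0`, because `H` lies in `im Γ`. So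
the differential is injective, hence invertible. The same computation with two different parameters
gives global injectivity (`injOn_omegaTilde`).

Surjectivity is a continuity argument. The target is convex, hence connected. The image is open by
the inverse function theorem, and relatively closed by properness (`closure_image_inter_subset`).
Properness has two halves.

Parameters stay bounded: `⟨Λ, ω̃(Λ)⟩ = m ∫ ψ` does not depend on `Λ`, whereas pairing with a
positive definite `Σ` in `im Γ` is coercive on the cone `G* Λ G ≥ 0`. Coercivity rests on
`exists_posDef_density`: such a `Σ` is the moment of an everywhere positive density, built
explicitly by state feedback and a Lyapunov equation.

Limits stay off the boundary: if `G* Λ G` is singular at `w` in a direction `v`, then `v* G* Λ G v`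
is `O(|z - w|)`, and the trace of `ω̃` dominates the integral of its reciprocal, which diverges
logarithmically (`eventually_le_traceLin`). Here the scalar prior enters only through its lower
bound `c`. -/

open scoped Matrix ComplexOrder

noncomputable section

namespace SpectralEstimation

open Matrix

/-! ### Quadratic forms and the trace pairing of Hermitian matrices. -/

namespace HermMat

variable {k : ℕ}

/-- The real quadratic form `v* X v` of a Hermitian matrix, as a linear functional of the matrix. -/
def quad (v : Fin k → ℂ) : HermMat k →ₗ[ℝ] ℝ where
  toFun X := (star v ⬝ᵥ X.toMat *ᵥ v).re
  map_add' X Y := by simp [add_mulVec, dotProduct_add]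
  map_smul' c X := by simp [smul_mulVec, dotProduct_smul]

theorem quad_apply (v : Fin k → ℂ) (X : HermMat k) :
    quad v X = (star v ⬝ᵥ X.toMat *ᵥ v).re := rfl

theorem ofReal_quad (v : Fin k → ℂ) (X : HermMat k) :
    (quad v X : ℂ) = star v ⬝ᵥ X.toMat *ᵥ v :=
  Complex.ext rfl (X.isHermitian_toMat.im_star_dotProduct_mulVec_self v).symm

theorem posDef_iff_quad {X : HermMat k} : X.toMat.PosDef ↔ ∀ v ≠ 0, 0 < quad v X := by
  rw [posDef_iff_dotProduct_mulVec, and_iff_right X.isHermitian_toMat]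
  refine forall₂_congr fun v _ => ?_
  rw [← ofReal_quad, Complex.zero_lt_real]

theorem posSemidef_iff_quad {X : HermMat k} : X.toMat.PosSemidef ↔ ∀ v, 0 ≤ quad v X := by
  rw [posSemidef_iff_dotProduct_mulVec, and_iff_right X.isHermitian_toMat]
  refine forall_congr' fun v => ?_
  rw [← ofReal_quad, Complex.zero_le_real]

theorem quad_smul (c : ℂ) (v : Fin k → ℂ) (X : HermMat k) :
    quad (c • v) X = ‖c‖ ^ 2 * quad v X := by
  simp only [quad_apply, mulVec_smul, star_smul, smul_dotProduct, dotProduct_smul, smul_eq_mul,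
    ← mul_assoc]
  rw [Complex.star_def, Complex.mul_conj, ← Complex.normSq_eq_norm_sq,
    Complex.re_ofReal_mul]

theorem continuous_quad {T : Type*} [TopologicalSpace T] {v : T → Fin k → ℂ} {X : T → HermMat k}
    (hv : Continuous v) (hX : Continuous X) : Continuous fun t => quad (v t) (X t) :=
  Complex.continuous_re.comp (hv.star.dotProduct ((continuous_toMat.comp hX).matrix_mulVec hv))

/-- Testing on a compact set of vectors is what makes positive definiteness an open condition. -/
theorem posDef_iff_quad_sphere {X : HermMat k} :
    X.toMat.PosDef ↔ ∀ v ∈ Metric.sphere (0 : Fin k → ℂ) 1, 0 < quad v X := by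
  rw [posDef_iff_quad]
  refine ⟨fun h v hv => h v (ne_zero_of_mem_unit_sphere ⟨v, hv⟩), fun h v hv => ?_⟩
  have hn : 0 < ‖v‖ := norm_pos_iff.2 hv
  have := h (((‖v‖⁻¹ : ℝ) : ℂ) • v) (by
    rw [mem_sphere_zero_iff_norm, norm_smul, Complex.norm_real, norm_inv, norm_norm,
      inv_mul_cancel₀ hn.ne'])
  rw [quad_smul] at this
  exact pos_of_mul_pos_right this (by positivity)

/-- The trace pairing `tr (X Y)` of Hermitian matrices. -/
def pairLin : HermMat k →ₗ[ℝ] HermMat k →ₗ[ℝ] ℝ :=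
  LinearMap.mk₂ ℝ (fun X Y => (X.toMat * Y.toMat).trace.re)
    (fun _ _ _ => by simp [Matrix.add_mul]) (fun _ _ _ => by simp)
    (fun _ _ _ => by simp [Matrix.mul_add]) (fun _ _ _ => by simp)

/-- The trace pairing as a continuous bilinear form. -/
def pair : HermMat k →L[ℝ] HermMat k →L[ℝ] ℝ :=
  LinearMap.toContinuousLinearMap
    ((LinearMap.toContinuousLinearMap (𝕜 := ℝ) (E := HermMat k) (F' := ℝ)).toLinearMap ∘ₗ pairLin)

theorem pair_apply (X Y : HermMat k) : pair X Y = (X.toMat * Y.toMat).trace.re := rfl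

theorem pair_self (X : HermMat k) : pair X X = ‖X‖ ^ 2 := by
  rw [norm_eq, Real.sq_sqrt (by positivity), pair_apply]
  conv_lhs => enter [1, 1, 2]; rw [← X.isHermitian_toMat.eq]
  simp only [trace, diag, mul_apply, conjTranspose_apply, Complex.re_sum]
  refine Finset.sum_congr rfl fun i _ => Finset.sum_congr rfl fun j _ => ?_
  rw [Complex.star_def, Complex.mul_conj, Complex.ofReal_re, Complex.normSq_eq_norm_sq]

end HermMat

/-! ### Positivity of traces of products. -/

theorem posDef_exists_isUnit_conjTranspose_mul_self {k : ℕ} {R : Matrix (Fin k) (Fin k) ℂ}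
    (hR : R.PosDef) : ∃ C : Matrix (Fin k) (Fin k) ℂ, IsUnit C ∧ R = Cᴴ * C := by
  open scoped MatrixOrder in
  obtain ⟨C, hC⟩ := CStarAlgebra.nonneg_iff_eq_star_mul_self.1 hR.posSemidef.nonneg
  refine ⟨C, ?_, hC⟩
  have := hR.isUnit
  rw [isUnit_iff_isUnit_det, hC, star_eq_conjTranspose, det_mul] at this
  rw [isUnit_iff_isUnit_det]
  exact isUnit_of_mul_isUnit_right this

theorem trace_mul_re_nonneg {k : ℕ} {Z R : Matrix (Fin k) (Fin k) ℂ} (hZ : Z.PosSemidef)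
    (hR : R.PosDef) : 0 ≤ (Z * R).trace.re := by
  obtain ⟨C, -, rfl⟩ := posDef_exists_isUnit_conjTranspose_mul_self hR
  rw [← Matrix.mul_assoc, trace_mul_comm, ← Matrix.mul_assoc]
  exact (Complex.le_def.1 (hZ.mul_mul_conjTranspose_same C).trace_nonneg).1

/-- With `R = C* C` the trace is that of the semidefinite matrix `C Z C*`, and a semidefinite matrix
of zero trace is zero. -/
theorem eq_zero_of_trace_mul_re {k : ℕ} {Z R : Matrix (Fin k) (Fin k) ℂ} (hZ : Z.PosSemidef)
    (hR : R.PosDef) (h : (Z * R).trace.re = 0) : Z = 0 := by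
  obtain ⟨C, hC, rfl⟩ := posDef_exists_isUnit_conjTranspose_mul_self hR
  rw [← Matrix.mul_assoc, trace_mul_comm, ← Matrix.mul_assoc] at h
  have hp := hZ.mul_mul_conjTranspose_same C
  have h0 : (C * Z * Cᴴ).trace = 0 :=
    Complex.ext h (Complex.le_def.1 hp.trace_nonneg).2.symm
  have h1 := hp.trace_eq_zero_iff.1 h0
  have hC' : IsUnit Cᴴ := by simpa [star_eq_conjTranspose] using hC.star
  rw [hC'.mul_left_eq_zero, hC.mul_right_eq_zero] at h1
  exact h1

theorem trace_sandwich_re_nonneg {k : ℕ} {Y P R : Matrix (Fin k) (Fin k) ℂ} (hY : Y.IsHermitian)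
    (hP : P.PosDef) (hR : R.PosDef) : 0 ≤ (Y * P * Y * R).trace.re := by
  have := hP.posSemidef.mul_mul_conjTranspose_same Y
  rw [hY.eq] at this
  exact trace_mul_re_nonneg this hR

/-- Source of strictness both for injectivity of `ω̃` and for injectivity of its differential: there
`Y = G* H G`, and `P`, `R` are inverses of compressions. -/
theorem eq_zero_of_trace_sandwich_re {k : ℕ} {Y P R : Matrix (Fin k) (Fin k) ℂ}
    (hY : Y.IsHermitian) (hP : P.PosDef) (hR : R.PosDef)
    (h : (Y * P * Y * R).trace.re = 0) : Y = 0 := by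
  have hs := hP.posSemidef.mul_mul_conjTranspose_same Y
  rw [hY.eq] at hs
  have h0 := eq_zero_of_trace_mul_re hs hR h
  obtain ⟨C, hC, rfl⟩ := posDef_exists_isUnit_conjTranspose_mul_self hP
  have h1 : (C * Y)ᴴ * (C * Y) = 0 := by
    rw [conjTranspose_mul, hY.eq, ← h0]; simp only [Matrix.mul_assoc]
  rw [conjTranspose_mul_self_eq_zero, hC.mul_right_eq_zero] at h1
  exact h1

/-- Cauchy–Schwarz for the pair of dual forms given by `Q` and `Q⁻¹`. -/
theorem norm_sq_dotProduct_le_inv {k : ℕ} {Q : Matrix (Fin k) (Fin k) ℂ} (hQ : Q.PosDef)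
    (y v : Fin k → ℂ) :
    ‖star y ⬝ᵥ v‖ ^ 2 ≤ (star y ⬝ᵥ Q⁻¹ *ᵥ y).re * (star v ⬝ᵥ Q *ᵥ v).re := by
  obtain ⟨C, hC, rfl⟩ := posDef_exists_isUnit_conjTranspose_mul_self hQ
  have hCd := (isUnit_iff_isUnit_det _).1 hC
  have hb : star v ⬝ᵥ (Cᴴ * C) *ᵥ v = star (C *ᵥ v) ⬝ᵥ (C *ᵥ v) := by
    rw [star_mulVec, ← dotProduct_mulVec, mulVec_mulVec]
  have ha : star y ⬝ᵥ (Cᴴ * C)⁻¹ *ᵥ y = star ((C⁻¹)ᴴ *ᵥ y) ⬝ᵥ ((C⁻¹)ᴴ *ᵥ y) := by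
    rw [star_mulVec, ← dotProduct_mulVec, mulVec_mulVec, conjTranspose_conjTranspose, Matrix.mul_inv_rev,
      conjTranspose_nonsing_inv]
  have hc : star y ⬝ᵥ v = star ((C⁻¹)ᴴ *ᵥ y) ⬝ᵥ (C *ᵥ v) := by
    rw [star_mulVec, ← dotProduct_mulVec, mulVec_mulVec, conjTranspose_conjTranspose,
      nonsing_inv_mul _ hCd, one_mulVec]
  rw [ha, hb, hc]
  -- In the coordinates `a = C⁻* y`, `b = C v` the claim is the Euclidean Cauchy–Schwarz inequality.
  generalize (C⁻¹)ᴴ *ᵥ y = a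
  generalize C *ᵥ v = b
  have := norm_inner_le_norm (𝕜 := ℂ) (WithLp.toLp 2 a) (WithLp.toLp 2 b)
  have h2 (c : Fin k → ℂ) : (star c ⬝ᵥ c).re = ‖WithLp.toLp 2 c‖ ^ 2 := by
    rw [← inner_self_eq_norm_sq (𝕜 := ℂ), EuclideanSpace.inner_toLp_toLp, dotProduct_comm]; rfl
  rw [h2, h2, ← mul_pow, dotProduct_comm, ← EuclideanSpace.inner_toLp_toLp]
  gcongr

end SpectralEstimation

/-! ### Means over the unit circle. -/

namespace SpectralEstimation

open Matrix

namespace FilterBank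

section CircleMean

variable {E F : Type*} [NormedAddCommGroup E] [NormedSpace ℝ E] [NormedAddCommGroup F]
  [NormedSpace ℝ F]

theorem intervalIntegrable_comp_exp {E : Type*} [NormedAddCommGroup E] {f : Circle → E} (hf : Continuous f) (a b : ℝ) :
    IntervalIntegrable (fun θ => f (Circle.exp θ)) MeasureTheory.volume a b :=
  (hf.comp Circle.exp.continuous).intervalIntegrable _ _

theorem circleMean_add {f g : Circle → E} (hf : Continuous f) (hg : Continuous g) :
    circleMean (fun z => f z + g z) = circleMean f + circleMean g := by
  simp only [circleMean]
  rw [intervalIntegral.integral_add (intervalIntegrable_comp_exp hf _ _)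
    (intervalIntegrable_comp_exp hg _ _), smul_add]

theorem circleMean_sub {f g : Circle → E} (hf : Continuous f) (hg : Continuous g) :
    circleMean (fun z => f z - g z) = circleMean f - circleMean g := by
  simp only [circleMean]
  rw [intervalIntegral.integral_sub (intervalIntegrable_comp_exp hf _ _)
    (intervalIntegrable_comp_exp hg _ _), smul_sub]

theorem circleMean_const [CompleteSpace E] (c : E) : circleMean (fun _ => c) = c := by
  rw [circleMean, intervalIntegral.integral_const, smul_smul]
  have : (2 * Real.pi)⁻¹ * (Real.pi - -Real.pi) = 1 := by
    field_simp; ring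
  rw [this, one_smul]

theorem map_circleMean [CompleteSpace E] [CompleteSpace F] (L : E →L[ℝ] F) {f : Circle → E}
    (hf : Continuous f) : L (circleMean f) = circleMean fun z => L (f z) := by
  simp only [circleMean, map_smul]
  rw [L.intervalIntegral_comp_comm (intervalIntegrable_comp_exp hf _ _)]

theorem circleMean_mono {f g : Circle → ℝ} (hf : Continuous f) (hg : Continuous g)
    (h : ∀ z, f z ≤ g z) : circleMean f ≤ circleMean g := by
  have hpi := Real.pi_pos
  refine smul_le_smul_of_nonneg_left ?_ (by positivity)
  exact intervalIntegral.integral_mono_on (by linarith) (intervalIntegrable_comp_exp hf _ _)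
    (intervalIntegrable_comp_exp hg _ _) fun θ _ => h _

theorem circleMean_nonneg {f : Circle → ℝ} (hf : Continuous f) (h : ∀ z, 0 ≤ f z) :
    0 ≤ circleMean f := by
  simpa only [circleMean_const] using circleMean_mono continuous_const hf h

theorem eq_zero_of_circleMean_eq_zero {f : Circle → ℝ} (hf : Continuous f) (h : ∀ z, 0 ≤ f z)
    (h0 : circleMean f = 0) (z : Circle) : f z = 0 := by
  by_contra hz
  have hpi := Real.pi_pos
  have : 0 < ∫ θ in (-Real.pi)..Real.pi, f (Circle.exp θ) :=
    intervalIntegral.integral_pos (by linarith) (hf.comp Circle.exp.continuous).continuousOn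
      (fun θ _ => h _) ⟨Complex.arg z, Set.Ioc_subset_Icc_self (Complex.arg_mem_Ioc _), by
        rw [Circle.exp_arg]; exact lt_of_le_of_ne (h z) (Ne.symm hz)⟩
  have h2 : 0 < circleMean f := by
    rw [circleMean, smul_eq_mul]; positivity
  exact h2.ne' h0

/-- The substitution `θ ↦ -θ`. The resolvent of a stable matrix is analytic outside the disc, so the
mean value property applies in the variable `z⁻¹`. -/
theorem circleMean_inv_eq_circleAverage {f : ℂ → E} [NormedSpace ℂ E] :
    circleMean (fun z => f ((z : ℂ)⁻¹)) = Real.circleAverage f 0 1 := by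
  have hp : Function.Periodic (fun θ : ℝ => f (circleMap 0 1 θ)) (2 * Real.pi) :=
    fun θ => by simp only [periodic_circleMap 0 1 θ]
  have h1 := hp.intervalIntegral_add_eq (-Real.pi) 0
  rw [circleMean, Real.circleAverage, ← zero_add (2 * Real.pi), ← h1]
  simp only [zero_add]
  rw [show -Real.pi + 2 * Real.pi = Real.pi by ring]
  congr 1
  conv_rhs => rw [← neg_neg Real.pi, ← intervalIntegral.integral_comp_neg, neg_neg]
  refine intervalIntegral.integral_congr fun θ _ => ?_
  simp [circleMap, Complex.exp_neg]

end CircleMean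

end FilterBank

/-! ### Resolvents of Schur stable matrices and the Lyapunov equation. -/

open scoped Matrix.Norms.Frobenius

/-- All eigenvalues of `A` lie in the open unit disc. -/
def SchurStable {k : ℕ} (A : Matrix (Fin k) (Fin k) ℂ) : Prop :=
  ∀ μ ∈ spectrum ℂ A, ‖μ‖ < 1

theorem SchurStable.isUnit_one_sub_smul {k : ℕ} {A : Matrix (Fin k) (Fin k) ℂ}
    (hA : SchurStable A) {w : ℂ} (hw : ‖w‖ ≤ 1) : IsUnit (1 - w • A) := by
  rcases eq_or_ne w 0 with rfl | h0
  · simp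
  have h1 : w⁻¹ ∉ spectrum ℂ A := fun h => by
    have := hA _ h
    rw [norm_inv] at this
    exact absurd this (not_lt.2 ((one_le_inv₀ (norm_pos_iff.2 h0)).2 hw))
  rw [spectrum.notMem_iff, Algebra.algebraMap_eq_smul_one] at h1
  have h2 : 1 - w • A = (Units.mk0 w h0) • (w⁻¹ • (1 : Matrix (Fin k) (Fin k) ℂ) - A) := by
    rw [Units.smul_mk0, smul_sub, smul_smul, mul_inv_cancel₀ h0, one_smul]
  rw [h2]
  exact h1.smul _

theorem SchurStable.isUnit_smul_one_sub {k : ℕ} {A : Matrix (Fin k) (Fin k) ℂ}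
    (hA : SchurStable A) (z : Circle) :
    IsUnit ((z : ℂ) • (1 : Matrix (Fin k) (Fin k) ℂ) - A) := by
  have h : (z : ℂ) ∉ spectrum ℂ A := fun h => absurd z.norm_coe (hA _ h).ne
  rwa [spectrum.notMem_iff, Algebra.algebraMap_eq_smul_one] at h

theorem SchurStable.continuous_resolvent {k : ℕ} {A : Matrix (Fin k) (Fin k) ℂ}
    (hA : SchurStable A) :
    Continuous fun z : Circle => ((z : ℂ) • (1 : Matrix (Fin k) (Fin k) ℂ) - A)⁻¹ := by
  have h1 : Continuous fun z : Circle => (z : ℂ) • (1 : Matrix (Fin k) (Fin k) ℂ) - A :=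
    ((continuous_subtype_val (p := fun x : ℂ => x ∈ Submonoid.unitSphere ℂ)).smul
      continuous_const).sub continuous_const
  simp only [Matrix.inv_def, Ring.inverse_eq_inv']
  exact (h1.matrix_det.inv₀ fun z =>
    ((isUnit_iff_isUnit_det _).1 (hA.isUnit_smul_one_sub z)).ne_zero).smul h1.matrix_adjugate

/-- The resolvent of a Schur stable matrix has zero mean over the unit circle. -/
theorem SchurStable.circleMean_resolvent {k : ℕ} {A : Matrix (Fin k) (Fin k) ℂ}
    (hA : SchurStable A) :
    FilterBank.circleMean
      (fun z : Circle => ((z : ℂ) • (1 : Matrix (Fin k) (Fin k) ℂ) - A)⁻¹) = 0 := by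
  -- This is `(zI - A)⁻¹` with `w = z⁻¹`: analytic on the closed disc and zero at the origin.
  let f : ℂ → Matrix (Fin k) (Fin k) ℂ := fun w => w • Ring.inverse (1 - w • A)
  have hd : ∀ w ∈ Metric.closedBall (0 : ℂ) |1|, DifferentiableAt ℂ f w := by
    intro w hw
    rw [abs_one, mem_closedBall_zero_iff] at hw
    obtain ⟨u, hu⟩ := hA.isUnit_one_sub_smul hw
    have h1 : DifferentiableAt ℂ (fun w : ℂ => 1 - w • A) w := by fun_prop
    have h2 : DifferentiableAt ℂ Ring.inverse (1 - w • A) := by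
      rw [← hu]; exact (hasFDerivAt_ringInverse u).differentiableAt
    exact differentiableAt_id.smul (h2.comp w h1)
  have hf : DiffContOnCl ℂ f (Metric.ball 0 |1|) := by
    refine DifferentiableOn.diffContOnCl fun w hw => (hd w ?_).differentiableWithinAt
    exact Metric.closure_ball_subset_closedBall hw
  have h0 := hf.circleAverage
  rw [← FilterBank.circleMean_inv_eq_circleAverage] at h0
  have hf0 : f 0 = 0 := zero_smul ℂ _
  rw [hf0] at h0
  rw [← h0]
  congr 1
  funext z
  have hz : (z : ℂ) ≠ 0 := Circle.coe_ne_zero z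
  have hz1 : ‖(z : ℂ)⁻¹‖ ≤ 1 := by rw [norm_inv, Circle.norm_coe, inv_one]
  have hu := (isUnit_iff_isUnit_det _).1 (hA.isUnit_one_sub_smul hz1)
  refine Matrix.inv_eq_left_inv ?_
  show ((z : ℂ)⁻¹ • Ring.inverse (1 - (z : ℂ)⁻¹ • A)) * _ = _
  rw [← nonsing_inv_eq_ringInverse]
  have : (z : ℂ) • (1 : Matrix (Fin k) (Fin k) ℂ) - A = (z : ℂ) • (1 - (z : ℂ)⁻¹ • A) := by
    rw [smul_sub, smul_smul, mul_inv_cancel₀ hz, one_smul]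
  rw [this, smul_mul_assoc, mul_smul_comm, smul_smul, inv_mul_cancel₀ hz, one_smul,
    nonsing_inv_mul _ hu]

/-- The Lyapunov (Stein) equation is solved by the mean of the resolvent conjugation. -/
theorem SchurStable.circleMean_lyapunov {k : ℕ} {A X : Matrix (Fin k) (Fin k) ℂ}
    (hA : SchurStable A) (hX : X.IsHermitian) :
    FilterBank.circleMean (fun z : Circle =>
      ((z : ℂ) • (1 : Matrix (Fin k) (Fin k) ℂ) - A)⁻¹ * (X - A * X * Aᴴ) *
        (((z : ℂ) • (1 : Matrix (Fin k) (Fin k) ℂ) - A)⁻¹)ᴴ) = X := by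
  let L : Matrix (Fin k) (Fin k) ℂ →ₗ[ℝ] Matrix (Fin k) (Fin k) ℂ :=
    { toFun := fun R => R * (A * X) + (R * (A * X))ᴴ
      map_add' := fun R R' => by simp only [Matrix.add_mul, conjTranspose_add]; abel
      map_smul' := fun c R => by simp }
  have hid : ∀ z : Circle,
      ((z : ℂ) • (1 : Matrix (Fin k) (Fin k) ℂ) - A)⁻¹ * (X - A * X * Aᴴ) *
        (((z : ℂ) • (1 : Matrix (Fin k) (Fin k) ℂ) - A)⁻¹)ᴴ
      = X + L.toContinuousLinearMap (((z : ℂ) • (1 : Matrix (Fin k) (Fin k) ℂ) - A)⁻¹) := by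
    intro z
    have hz : (z : ℂ) * star (z : ℂ) = 1 := by
      rw [Complex.star_def, Complex.mul_conj, Circle.normSq_coe, Complex.ofReal_one]
    have hu := (isUnit_iff_isUnit_det _).1 (hA.isUnit_smul_one_sub z)
    show _ = X + (_ * (A * X) + (_ * (A * X))ᴴ)
    set M := (z : ℂ) • (1 : Matrix (Fin k) (Fin k) ℂ) - A with hM
    have hMH : Mᴴ = star (z : ℂ) • (1 : Matrix (Fin k) (Fin k) ℂ) - Aᴴ := by
      rw [hM, conjTranspose_sub, conjTranspose_smul, conjTranspose_one]
    have h1 : M⁻¹ * M = 1 := nonsing_inv_mul _ hu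
    have h2 : Mᴴ * M⁻¹ᴴ = 1 := by rw [← conjTranspose_mul, h1, conjTranspose_one]
    -- Uses `|z| = 1`. Conjugating by `M⁻¹` leaves `X` plus terms linear in the resolvent or its
    -- adjoint, whose means vanish.
    have key : X - A * X * Aᴴ = M * X * Mᴴ + M * (X * Aᴴ) + A * X * Mᴴ := by
      rw [hMH, hM]
      simp only [Matrix.sub_mul, Matrix.mul_sub, smul_mul_assoc, mul_smul_comm, Matrix.one_mul,
        Matrix.mul_one, Matrix.mul_assoc, smul_sub, smul_smul]
      rw [mul_comm (star (z : ℂ)), hz, one_smul]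
      abel
    calc _ = (M⁻¹ * M) * X * (Mᴴ * M⁻¹ᴴ) + (M⁻¹ * M) * (X * Aᴴ) * M⁻¹ᴴ
            + M⁻¹ * (A * X) * (Mᴴ * M⁻¹ᴴ) := by
          rw [key]; simp only [Matrix.mul_add, Matrix.add_mul, Matrix.mul_assoc]
      _ = _ := by
          rw [h1, h2]
          simp only [Matrix.one_mul, Matrix.mul_one, conjTranspose_mul, hX.eq, Matrix.mul_assoc]
          abel
  have hm := FilterBank.map_circleMean L.toContinuousLinearMap hA.continuous_resolvent
  rw [hA.circleMean_resolvent] at hm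
  refine (congrArg FilterBank.circleMean (funext hid)).trans ?_
  refine (FilterBank.circleMean_add continuous_const
    (L.toContinuousLinearMap.continuous.comp hA.continuous_resolvent)).trans ?_
  rw [FilterBank.circleMean_const]
  exact (congrArg (X + ·) (hm.symm.trans (map_zero L))).trans (add_zero _)

end SpectralEstimation

/-! ### Reachability and the positive elements of the range of `Γ`. -/

namespace SpectralEstimation

open Matrix

open scoped Matrix.Norms.Frobenius

theorem mulVec_injective_of_rank {ι : Type*} [Fintype ι] {k : ℕ} {M : Matrix ι (Fin k) ℂ}
    (hM : M.rank = k) : Function.Injective M.mulVec := by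
  have h := M.mulVecLin.finrank_range_add_finrank_ker
  have h2 : Module.finrank ℂ (LinearMap.range M.mulVecLin) = k := hM
  rw [h2, Module.finrank_fin_fun, Nat.add_eq_left, Submodule.finrank_eq_zero,
    LinearMap.ker_eq_bot] at h
  exact h

namespace FilterBank

variable {n m : ℕ} (S : FilterBank n m)

theorem isUnit_det (z : Circle) :
    IsUnit ((z : ℂ) • (1 : Matrix (Fin n) (Fin n) ℂ) - S.A).det :=
  (S.det_ne_zero z).isUnit

theorem resolvent_mul_G (z : Circle) :
    ((z : ℂ) • (1 : Matrix (Fin n) (Fin n) ℂ) - S.A) * S.G z = S.B := by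
  rw [G, ← Matrix.mul_assoc, mul_nonsing_inv _ (S.isUnit_det z), Matrix.one_mul]

theorem A_mul_G (z : Circle) : S.A * S.G z = (z : ℂ) • S.G z - S.B := by
  have := S.resolvent_mul_G z
  generalize (z : ℂ) = w at this ⊢
  rw [Matrix.sub_mul, Matrix.smul_mul, Matrix.one_mul] at this
  rw [← this]; abel

theorem mulVec_B_injective : Function.Injective S.B.mulVec :=
  mulVec_injective_of_rank S.fullColumnRank

theorem mulVec_G_injective (z : Circle) : Function.Injective (S.G z).mulVec := by
  intro v w h
  apply S.mulVec_B_injective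
  rw [← S.resolvent_mul_G z, ← mulVec_mulVec, ← mulVec_mulVec, h]

theorem eq_zero_of_vecMul_reachability {w : Fin n → ℂ}
    (h : ∀ k : ℕ, w ᵥ* (S.A ^ k * S.B) = 0) : w = 0 := by
  refine mulVec_injective_of_rank ((rank_transpose _).trans S.reachable)
    (a₂ := 0) ?_
  rw [mulVec_transpose, mulVec_zero]
  funext p
  exact congrFun (h p.1) p.2

theorem circleMean_G : circleMean S.G = 0 := by
  have hA : SchurStable S.A := S.schurStable
  let L : Matrix (Fin n) (Fin n) ℂ →ₗ[ℝ] Matrix (Fin n) (Fin m) ℂ :=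
    { toFun := fun R => R * S.B
      map_add' := fun R R' => Matrix.add_mul _ _ _
      map_smul' := fun c R => Matrix.smul_mul _ _ _ }
  have h := map_circleMean L.toContinuousLinearMap hA.continuous_resolvent
  rw [hA.circleMean_resolvent] at h
  exact h.symm.trans (map_zero L)

/-- If `w G(z)` is independent of `z`, then it vanishes. -/
theorem eq_zero_of_vecMul_G_eq {w : Fin n → ℂ} {c : Fin m → ℂ} (h : ∀ z, w ᵥ* S.G z = c) :
    c = 0 := by
  let L : Matrix (Fin n) (Fin m) ℂ →ₗ[ℝ] (Fin m → ℂ) :=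
    { toFun := fun R => w ᵥ* R
      map_add' := fun R R' => vecMul_add _ _ _
      map_smul' := fun c R => vecMul_smul _ _ _ }
  have h1 := map_circleMean L.toContinuousLinearMap S.continuous_G
  rw [circleMean_G] at h1
  have h2 : (fun z => L.toContinuousLinearMap (S.G z)) = fun _ => c := funext h
  exact (circleMean_const c).symm.trans
    ((congrArg circleMean h2).symm.trans (h1.symm.trans (map_zero L)))

/-- Since `A G = z G - B`, the row `w A G` is the constant `-w B`, and `G` has mean zero. Iterating
reaches every `w Aᵏ B`. -/
theorem vecMul_A_mul_G {w : Fin n → ℂ} (h : ∀ z, w ᵥ* S.G z = 0) :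
    w ᵥ* S.B = 0 ∧ ∀ z, (w ᵥ* S.A) ᵥ* S.G z = 0 := by
  have h1 : ∀ z, (w ᵥ* S.A) ᵥ* S.G z = -(w ᵥ* S.B) := fun z => by
    rw [vecMul_vecMul, A_mul_G, vecMul_sub, vecMul_smul, h, smul_zero, zero_sub]
  have h2 := S.eq_zero_of_vecMul_G_eq h1
  exact ⟨neg_eq_zero.1 h2, fun z => (h1 z).trans h2⟩

/-- By reachability the rows of `G` are linearly independent functions on the circle. -/
theorem eq_zero_of_vecMul_G {w : Fin n → ℂ} (h : ∀ z, w ᵥ* S.G z = 0) : w = 0 := by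
  have hk : ∀ k : ℕ, ∀ z, (w ᵥ* S.A ^ k) ᵥ* S.G z = 0 := by
    intro k
    induction k with
    | zero => simpa using h
    | succ k ih =>
      rw [pow_succ, ← vecMul_vecMul]
      exact (S.vecMul_A_mul_G ih).2
  refine S.eq_zero_of_vecMul_reachability fun k => ?_
  rw [← vecMul_vecMul]
  exact (S.vecMul_A_mul_G (hk k)).1

theorem toMat_Gam (Φ : C(Circle, HermMat m)) :
    (S.Gam Φ).toMat = circleMean fun z => S.G z * (Φ z).toMat * (S.G z)ᴴ :=
  map_circleMean (LinearMap.toContinuousLinearMap HermMat.toMat) (S.momentIntegrand Φ).continuous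

/-- Elements of the range of `Γ` satisfy `P (Σ - A Σ A*) P* = 0` as soon as `P` annihilates `B`. -/
theorem sandwich_Gam (Φ : C(Circle, HermMat m)) {P : Matrix (Fin n) (Fin n) ℂ} (hP : P * S.B = 0) :
    P * ((S.Gam Φ).toMat - S.A * (S.Gam Φ).toMat * S.Aᴴ) * Pᴴ = 0 := by
  let L : HermMat n →ₗ[ℝ] Matrix (Fin n) (Fin n) ℂ :=
    { toFun := fun X => P * (X.toMat - S.A * X.toMat * S.Aᴴ) * Pᴴ
      map_add' := fun X Y => by
        simp only [map_add, Matrix.mul_add, Matrix.add_mul, Matrix.mul_sub, Matrix.sub_mul]; abel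
      map_smul' := fun c X => by
        simp only [map_smul, Matrix.mul_smul, Matrix.smul_mul, ← smul_sub, RingHom.id_apply] }
  have h : L.toContinuousLinearMap (S.Gam Φ) = _ :=
    map_circleMean L.toContinuousLinearMap (S.momentIntegrand Φ).continuous
  refine h.trans ?_
  have h0 : ∀ z, L.toContinuousLinearMap (S.momentIntegrand Φ z) = 0 := by
    intro z
    show P * (S.G z * (Φ z).toMat * (S.G z)ᴴ
      - S.A * (S.G z * (Φ z).toMat * (S.G z)ᴴ) * S.Aᴴ) * Pᴴ = 0
    have hz : (z : ℂ) * star (z : ℂ) = 1 := by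
      rw [Complex.star_def, Complex.mul_conj, Circle.normSq_coe, Complex.ofReal_one]
    have hA := S.A_mul_G z
    generalize (z : ℂ) = w at hz hA
    -- Modulo the range of `B`, `A` acts on `G` as multiplication by `z`; the two factors `z` and
    -- `z̄` then cancel.
    have h1 : P * (S.A * S.G z) = w • (P * S.G z) := by
      rw [hA, Matrix.mul_sub, hP, sub_zero, Matrix.mul_smul]
    have h2 : P * (S.A * (S.G z * (Φ z).toMat * (S.G z)ᴴ) * S.Aᴴ) * Pᴴ
        = (P * (S.A * S.G z)) * (Φ z).toMat * (P * (S.A * S.G z))ᴴ := by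
      simp only [conjTranspose_mul, Matrix.mul_assoc]
    rw [Matrix.mul_sub, Matrix.sub_mul, h2, h1]
    simp only [conjTranspose_mul, conjTranspose_smul, Matrix.smul_mul, Matrix.mul_smul, smul_smul,
      Matrix.mul_assoc]
    rw [mul_comm (star w), hz, one_smul, sub_self]
  exact (congrArg circleMean (funext h0)).trans (circleMean_const 0)

/-- A positive definite element of the range of `Γ` is the covariance of a positive density. -/
theorem exists_posDef_density {X : HermMat n} (hX : X ∈ S.imGam) (hpos : X.toMat.PosDef) :
    ∃ Φ : C(Circle, HermMat m), (∀ z, (Φ z).toMat.PosDef) ∧ S.Gam Φ = X := by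
  obtain ⟨Ψ, hΨ⟩ := hX
  -- `N` normalizes `B N B* X⁻¹` to be the projection onto the range of `B` that is orthogonal for
  -- the form `X⁻¹`; `P` is the complementary projection.
  set N := (S.Bᴴ * X.toMat⁻¹ * S.B)⁻¹ with hN
  have hN0 : (S.Bᴴ * X.toMat⁻¹ * S.B).PosDef :=
    hpos.inv.conjTranspose_mul_mul_same S.mulVec_B_injective
  have hNpos : N.PosDef := hN0.inv
  have hNu : N * (S.Bᴴ * X.toMat⁻¹ * S.B) = 1 :=
    nonsing_inv_mul _ ((isUnit_iff_isUnit_det _).1 hN0.isUnit)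
  have hXu : X.toMat⁻¹ * X.toMat = 1 :=
    nonsing_inv_mul _ ((isUnit_iff_isUnit_det _).1 hpos.isUnit)
  set P := 1 - S.B * N * S.Bᴴ * X.toMat⁻¹ with hP
  have hPB : P * S.B = 0 := by
    calc P * S.B = S.B - S.B * (N * (S.Bᴴ * X.toMat⁻¹ * S.B)) := by
          rw [hP]; simp only [Matrix.sub_mul, Matrix.one_mul, Matrix.mul_assoc]
      _ = 0 := by rw [hNu, Matrix.mul_one, sub_self]
  have hPX : P * X.toMat = X.toMat - S.B * N * S.Bᴴ := by
    rw [hP, Matrix.sub_mul, Matrix.one_mul, Matrix.mul_assoc _ X.toMat⁻¹, hXu, Matrix.mul_one]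
  have hPXP : P * X.toMat * Pᴴ = X.toMat - S.B * N * S.Bᴴ := by
    have h1 : S.Bᴴ * Pᴴ = 0 := by rw [← conjTranspose_mul, hPB, conjTranspose_zero]
    have h2 : X.toMat * Pᴴ = X.toMat - S.B * N * S.Bᴴ := by
      have := congrArg conjTranspose hPX
      rw [conjTranspose_mul, X.isHermitian_toMat.eq] at this
      rw [this]
      simp only [conjTranspose_sub, X.isHermitian_toMat.eq, conjTranspose_mul, conjTranspose_conjTranspose, hNpos.isHermitian.eq,
        Matrix.mul_assoc]
    rw [hPX, Matrix.sub_mul, Matrix.mul_assoc _ S.Bᴴ, h1, Matrix.mul_zero, sub_zero, h2]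
  -- Feedback gain: the closed loop `F = P A = A - B K` turns the range condition into the Lyapunov
  -- equation `X - F X F* = B N B*`.
  set K := N * S.Bᴴ * X.toMat⁻¹ * S.A with hK
  set F := P * S.A with hF
  have hFK : F = S.A - S.B * K := by
    rw [hF, hP, hK]; simp only [Matrix.sub_mul, Matrix.one_mul, Matrix.mul_assoc]
  have hlyap : X.toMat - F * X.toMat * Fᴴ = S.B * N * S.Bᴴ := by
    have h1 := S.sandwich_Gam Ψ hPB
    rw [hΨ, Matrix.mul_sub, Matrix.sub_mul, hPXP, sub_eq_zero] at h1
    have h2 : F * X.toMat * Fᴴ = P * (S.A * X.toMat * S.Aᴴ) * Pᴴ := by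
      rw [hF]; simp only [conjTranspose_mul, Matrix.mul_assoc]
    rw [h2, ← h1, sub_sub_cancel]
  -- A left eigenvector `v` with `|μ| ≥ 1` makes the Lyapunov equation read nonpositive =
  -- nonnegative, so `v B = 0`. Feedback is then invisible to `v`, and `μ` is an eigenvalue of the
  -- stable `A`.
  have hFs : SchurStable F := by
    intro μ hμ
    by_contra! hge
    rw [spectrum.mem_iff, Algebra.algebraMap_eq_smul_one, isUnit_iff_isUnit_det,
      isUnit_iff_ne_zero, not_not, ← exists_vecMul_eq_zero_iff] at hμ
    obtain ⟨v, hv, hvF⟩ := hμ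
    rw [vecMul_sub, vecMul_smul, vecMul_one, sub_eq_zero] at hvF
    have hq : HermMat.quad (star v) X - HermMat.quad (Fᴴ *ᵥ star v) X
        = (star (S.Bᴴ *ᵥ star v) ⬝ᵥ N *ᵥ (S.Bᴴ *ᵥ star v)).re := by
      have h1 := congrArg (fun M => (star (star v) ⬝ᵥ M *ᵥ star v).re) hlyap
      simp only [sub_mulVec, dotProduct_sub, Complex.sub_re] at h1
      simp only [HermMat.quad_apply]
      rw [star_mulVec, star_mulVec, conjTranspose_conjTranspose, conjTranspose_conjTranspose,
        ← dotProduct_mulVec, ← dotProduct_mulVec, mulVec_mulVec, mulVec_mulVec, mulVec_mulVec,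
        mulVec_mulVec]
      exact h1
    have hFv : Fᴴ *ᵥ star v = star μ • star v := by
      rw [← star_vecMul, ← hvF, star_smul]
    rw [hFv, HermMat.quad_smul, norm_star] at hq
    have hXv := HermMat.posDef_iff_quad.1 hpos (star v) (star_ne_zero.2 hv)
    have hBv : S.Bᴴ *ᵥ star v = 0 := by
      by_contra hne
      have := (Complex.lt_def.1 (hNpos.dotProduct_mulVec_pos hne)).1
      rw [← hq, Complex.zero_re] at this
      nlinarith [mul_le_mul_of_nonneg_right (one_le_pow₀ hge : 1 ≤ ‖μ‖ ^ 2) hXv.le]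
    have hvB : v ᵥ* S.B = 0 := by
      rw [← star_vecMul, star_eq_zero] at hBv; exact hBv
    have hvA : v ᵥ* S.A = μ • v := by
      rw [hvF, hFK, vecMul_sub, ← vecMul_vecMul, hvB, zero_vecMul, sub_zero]
    refine absurd (S.schurStable μ ?_) (not_lt.2 hge)
    rw [spectrum.mem_iff, Algebra.algebraMap_eq_smul_one, isUnit_iff_isUnit_det,
      isUnit_iff_ne_zero, not_not, ← exists_vecMul_eq_zero_iff]
    exact ⟨v, hv, by rw [vecMul_sub, vecMul_smul, vecMul_one, hvA, sub_self]⟩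
  -- Return difference of the feedback loop: `G T⁻¹` is the closed-loop transfer function `(zI -
  -- F)⁻¹ B`.
  let T : Circle → Matrix (Fin m) (Fin m) ℂ := fun z => 1 + K * S.G z
  have hres : ∀ z : Circle, ((z : ℂ) • (1 : Matrix (Fin n) (Fin n) ℂ) - F) * S.G z = S.B * T z := by
    intro z
    have h1 : (z : ℂ) • (1 : Matrix (Fin n) (Fin n) ℂ) - F
        = ((z : ℂ) • (1 : Matrix (Fin n) (Fin n) ℂ) - S.A) + S.B * K := by rw [hFK]; abel
    rw [h1, Matrix.add_mul, resolvent_mul_G, Matrix.mul_add, Matrix.mul_one, Matrix.mul_assoc]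
  have hTu : ∀ z, IsUnit (T z) := by
    intro z
    rw [← mulVec_injective_iff_isUnit]
    refine (injective_iff_map_eq_zero (T z).mulVecLin).2 fun x hx => ?_
    rw [mulVecLin_apply] at hx
    have h1 : S.G z *ᵥ x = 0 := by
      have hu := (isUnit_iff_isUnit_det _).1 (hFs.isUnit_smul_one_sub z)
      have h2 := congrArg (fun M => M *ᵥ x) (hres z)
      simp only [← mulVec_mulVec, hx, mulVec_zero] at h2
      generalize (z : ℂ) • (1 : Matrix (Fin n) (Fin n) ℂ) - F = M at hu h2
      rw [← one_mulVec (S.G z *ᵥ x), ← nonsing_inv_mul M hu, ← mulVec_mulVec, h2, mulVec_zero]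
    exact S.mulVec_G_injective z (h1.trans (mulVec_zero _).symm)
  have hGT : ∀ z : Circle, S.G z * (T z)⁻¹
      = ((z : ℂ) • (1 : Matrix (Fin n) (Fin n) ℂ) - F)⁻¹ * S.B := by
    intro z
    have hu := (isUnit_iff_isUnit_det _).1 (hFs.isUnit_smul_one_sub z)
    have hu2 := (isUnit_iff_isUnit_det _).1 (hTu z)
    calc _ = (((z : ℂ) • (1 : Matrix (Fin n) (Fin n) ℂ) - F)⁻¹ *
            (((z : ℂ) • (1 : Matrix (Fin n) (Fin n) ℂ) - F) * S.G z)) * (T z)⁻¹ := by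
          rw [← Matrix.mul_assoc _ _ (S.G z), nonsing_inv_mul _ hu, Matrix.one_mul]
      _ = _ := by
          rw [hres, Matrix.mul_assoc, Matrix.mul_assoc, mul_nonsing_inv _ hu2, Matrix.mul_one]
  have hTc : Continuous T := continuous_const.add (continuous_const.matrix_mul S.continuous_G)
  have hTic : Continuous fun z => (T z)⁻¹ := by
    simp only [Matrix.inv_def, Ring.inverse_eq_inv']
    exact (hTc.matrix_det.inv₀ fun z =>
      ((isUnit_iff_isUnit_det _).1 (hTu z)).ne_zero).smul hTc.matrix_adjugate
  have hΦpos : ∀ z, ((T z)⁻¹ * N * ((T z)⁻¹)ᴴ).PosDef := fun z =>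
    (IsUnit.posDef_star_right_conjugate_iff
      ((isUnit_nonsing_inv_iff).2 (hTu z))).2 hNpos
  refine ⟨⟨fun z => HermMat.ofMat _ (hΦpos z).isHermitian, HermMat.continuous_ofMat
    ((hTic.matrix_mul continuous_const).matrix_mul hTic.matrix_conjTranspose) _⟩, hΦpos, ?_⟩
  apply HermMat.toMat_injective
  rw [toMat_Gam]
  -- The Lyapunov integral of `F` is exactly the moment of the density `T⁻¹ N T⁻*`.
  rw [← hFs.circleMean_lyapunov X.isHermitian_toMat, hlyap]
  congr 1
  funext z
  show S.G z * ((T z)⁻¹ * N * ((T z)⁻¹)ᴴ) * (S.G z)ᴴ = _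
  calc _ = (S.G z * (T z)⁻¹) * N * (S.G z * (T z)⁻¹)ᴴ := by
        simp only [conjTranspose_mul, Matrix.mul_assoc]
    _ = _ := by rw [hGT]; simp only [conjTranspose_mul, Matrix.mul_assoc]

end FilterBank

end SpectralEstimation

/-! ### Duality between `Γ` and compression: injectivity and coercivity. -/

namespace SpectralEstimation

open Matrix

namespace FilterBank

variable {n m : ℕ} (S : FilterBank n m)

/-- The compression `G* Λ G` of a Hermitian matrix to the input space. -/
def compress (Λ : HermMat n) (z : Circle) : Matrix (Fin m) (Fin m) ℂ :=
  (S.G z)ᴴ * Λ.toMat * S.G z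

theorem isHermitian_compress (Λ : HermMat n) (z : Circle) : (S.compress Λ z).IsHermitian :=
  isHermitian_conjTranspose_mul_mul _ Λ.isHermitian_toMat

theorem continuous_compress (Λ : HermMat n) : Continuous (S.compress Λ) :=
  (S.continuous_G.matrix_conjTranspose.matrix_mul continuous_const).matrix_mul S.continuous_G

theorem compress_add (Λ Λ' : HermMat n) (z : Circle) :
    S.compress (Λ + Λ') z = S.compress Λ z + S.compress Λ' z := by
  simp only [compress, map_add, Matrix.mul_add, Matrix.add_mul]

theorem compress_smul (c : ℝ) (Λ : HermMat n) (z : Circle) :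
    S.compress (c • Λ) z = c • S.compress Λ z := by
  simp only [compress, map_smul, Matrix.mul_smul, Matrix.smul_mul]

theorem compress_sub (Λ Λ' : HermMat n) (z : Circle) :
    S.compress (Λ - Λ') z = S.compress Λ z - S.compress Λ' z := by
  simp only [compress, map_sub, Matrix.mul_sub, Matrix.sub_mul]

theorem quad_compress (Λ : HermMat n) (z : Circle) (v : Fin m → ℂ) :
    (star v ⬝ᵥ S.compress Λ z *ᵥ v).re = HermMat.quad (S.G z *ᵥ v) Λ := by
  rw [HermMat.quad_apply, compress, star_mulVec, ← dotProduct_mulVec, mulVec_mulVec, mulVec_mulVec,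
    Matrix.mul_assoc]

theorem compress_posDef_iff (Λ : HermMat n) (z : Circle) :
    (S.compress Λ z).PosDef ↔
      ∀ v ∈ Metric.sphere (0 : Fin m → ℂ) 1, 0 < HermMat.quad (S.G z *ᵥ v) Λ := by
  have := HermMat.posDef_iff_quad_sphere (X := HermMat.ofMat _ (S.isHermitian_compress Λ z))
  simp only [HermMat.quad_apply, HermMat.toMat_ofMat, quad_compress] at this
  exact this

theorem compress_posSemidef_iff (Λ : HermMat n) (z : Circle) :
    (S.compress Λ z).PosSemidef ↔ ∀ v, 0 ≤ HermMat.quad (S.G z *ᵥ v) Λ := by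
  have := HermMat.posSemidef_iff_quad (X := HermMat.ofMat _ (S.isHermitian_compress Λ z))
  simp only [HermMat.quad_apply, HermMat.toMat_ofMat, quad_compress] at this
  exact this

theorem compress_posDef {Λ : HermMat n} (h : Λ.toMat.PosDef) (z : Circle) :
    (S.compress Λ z).PosDef :=
  h.conjTranspose_mul_mul_same (S.mulVec_G_injective z)

theorem toMat_density (ψ : C(Circle, ℝ)) (Λ : S.Lplus) (z : Circle) :
    (S.density ψ Λ z).toMat = ψ z • (S.compress Λ.1 z)⁻¹ :=
  map_smul HermMat.toMat (ψ z) _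

theorem continuous_trace_re {f g : Circle → Matrix (Fin m) (Fin m) ℂ} (hf : Continuous f)
    (hg : Continuous g) : Continuous fun z => (f z * g z).trace.re :=
  Complex.continuous_re.comp (hf.matrix_mul hg).matrix_trace

theorem continuous_compress_mul (Λ : HermMat n) (Φ : C(Circle, HermMat m)) :
    Continuous fun z => (S.compress Λ z * (Φ z).toMat).trace.re :=
  continuous_trace_re (S.continuous_compress Λ) (HermMat.continuous_toMat.comp Φ.continuous)

/-- The adjoint of `Γ` is the compression. -/
theorem pair_Gam (Λ : HermMat n) (Φ : C(Circle, HermMat m)) :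
    HermMat.pair Λ (S.Gam Φ) = circleMean fun z => (S.compress Λ z * (Φ z).toMat).trace.re := by
  refine (map_circleMean (HermMat.pair Λ) (S.momentIntegrand Φ).continuous).trans ?_
  refine congrArg circleMean (funext fun z => ?_)
  show (Λ.toMat * (S.G z * (Φ z).toMat * (S.G z)ᴴ)).trace.re = _
  rw [← Matrix.mul_assoc, trace_mul_comm, compress]
  simp only [Matrix.mul_assoc]

/-- The kernel of the adjoint of `Γ` is orthogonal to `im Γ`; this is why parameters are restricted
to `im Γ`. -/
theorem eq_zero_of_compress_eq_zero {Λ : HermMat n} (hΛ : Λ ∈ S.imGam)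
    (h : ∀ z, S.compress Λ z = 0) : Λ = 0 := by
  obtain ⟨Φ, rfl⟩ := hΛ
  have h1 := S.pair_Gam (S.Gam Φ) Φ
  simp only [h, Matrix.zero_mul, trace_zero, Complex.zero_re, circleMean_const] at h1
  rwa [HermMat.pair_self, sq_eq_zero_iff, norm_eq_zero] at h1

theorem quad_mul_mul_conjTranspose (v : Fin n → ℂ) (z : Circle) (X : HermMat m) :
    (star v ⬝ᵥ (S.G z * X.toMat * (S.G z)ᴴ) *ᵥ v).re = HermMat.quad ((S.G z)ᴴ *ᵥ v) X := by
  rw [HermMat.quad_apply, star_mulVec, conjTranspose_conjTranspose, ← dotProduct_mulVec,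
    mulVec_mulVec, mulVec_mulVec, Matrix.mul_assoc]

theorem quad_Gam (v : Fin n → ℂ) (Φ : C(Circle, HermMat m)) :
    HermMat.quad v (S.Gam Φ) = circleMean fun z => HermMat.quad ((S.G z)ᴴ *ᵥ v) (Φ z) := by
  have h : HermMat.quad v (S.Gam Φ) = circleMean fun z => HermMat.quad v (S.momentIntegrand Φ z) :=
    map_circleMean (HermMat.quad v).toContinuousLinearMap (S.momentIntegrand Φ).continuous
  rw [h]
  exact congrArg circleMean (funext fun z => S.quad_mul_mul_conjTranspose v z (Φ z))

theorem continuous_quad_conjTranspose_G (v : Fin n → ℂ) (Φ : C(Circle, HermMat m)) :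
    Continuous fun z => HermMat.quad ((S.G z)ᴴ *ᵥ v) (Φ z) :=
  HermMat.continuous_quad (S.continuous_G.matrix_conjTranspose.matrix_mulVec continuous_const)
    Φ.continuous

/-- A null vector `v` of the moment would satisfy `v* G = 0` on the whole circle, which reachability
excludes. -/
theorem Gam_posDef {Φ : C(Circle, HermMat m)} (hΦ : ∀ z, (Φ z).toMat.PosDef) :
    (S.Gam Φ).toMat.PosDef := by
  refine HermMat.posDef_iff_quad.2 fun v hv => ?_
  have hc := S.continuous_quad_conjTranspose_G v Φ
  have hnn : ∀ z, 0 ≤ HermMat.quad ((S.G z)ᴴ *ᵥ v) (Φ z) := fun z =>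
    HermMat.posSemidef_iff_quad.1 (hΦ z).posSemidef _
  rw [quad_Gam]
  refine lt_of_le_of_ne (circleMean_nonneg hc hnn) fun he => hv (star_eq_zero.1 ?_)
  refine S.eq_zero_of_vecMul_G fun z => ?_
  have h2 := eq_zero_of_circleMean_eq_zero hc hnn he.symm z
  have h3 : (S.G z)ᴴ *ᵥ v = 0 := by
    by_contra hne
    exact (HermMat.posDef_iff_quad.1 (hΦ z) _ hne).ne' h2
  rw [← conjTranspose_conjTranspose (S.G z), ← star_mulVec, h3, star_zero]

/-- The dual cone of the positive definite covariances contains every `Λ` with `G* Λ G ≥ 0`. -/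
theorem pair_pos {Λ X : HermMat n} (hΛ : Λ ∈ S.imGam) (h0 : Λ ≠ 0)
    (h : ∀ z, (S.compress Λ z).PosSemidef) (hX : X ∈ S.imGam) (hpos : X.toMat.PosDef) :
    0 < HermMat.pair Λ X := by
  -- An arbitrary preimage of `X` under `Γ` need not be positive; a positive one makes the integrand
  -- of the pairing nonnegative pointwise.
  obtain ⟨Φ, hΦ, rfl⟩ := S.exists_posDef_density hX hpos
  rw [pair_Gam]
  have hc := S.continuous_compress_mul Λ Φ
  have hnn : ∀ z, 0 ≤ (S.compress Λ z * (Φ z).toMat).trace.re := fun z =>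
    trace_mul_re_nonneg (h z) (hΦ z)
  refine lt_of_le_of_ne (circleMean_nonneg hc hnn) fun he => h0 ?_
  exact S.eq_zero_of_compress_eq_zero hΛ fun z => eq_zero_of_trace_mul_re (h z) (hΦ z)
    (eq_zero_of_circleMean_eq_zero hc hnn he.symm z)

variable {S}

theorem compress_posDef_of_mem {Λ : S.imGam} (hΛ : Λ ∈ S.LplusGam) (z : Circle) :
    (S.compress (Λ : HermMat n) z).PosDef := hΛ z

theorem coe_omegaTilde (ψ : C(Circle, ℝ)) {Λ : S.imGam} (hΛ : Λ ∈ S.LplusGam) :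
    (S.omegaTilde ψ Λ : HermMat n) = S.Gam (S.density ψ ⟨Λ, hΛ⟩) := by
  rw [omegaTilde, dif_pos hΛ]; rfl

theorem imPlusGam_subset_LplusGam : S.imPlusGam ⊆ S.LplusGam :=
  fun _ h z => S.compress_posDef h z

/-- The pairing of `Λ'` with `∫ ψ G (G* Λ G)⁻¹ G*`. -/
theorem pair_omegaTilde (ψ : C(Circle, ℝ)) {Λ : S.imGam} (hΛ : Λ ∈ S.LplusGam)
    (Λ' : HermMat n) : HermMat.pair Λ' (S.omegaTilde ψ Λ : HermMat n) =
      circleMean fun z => ψ z * (S.compress Λ' z * (S.compress Λ z)⁻¹).trace.re := by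
  rw [coe_omegaTilde ψ hΛ, pair_Gam]
  refine congrArg circleMean (funext fun z => ?_)
  rw [toMat_density, Matrix.mul_smul, trace_smul, Complex.smul_re, smul_eq_mul]

theorem continuous_inv_compress {Λ : S.imGam} (hΛ : Λ ∈ S.LplusGam) :
    Continuous fun z => (S.compress Λ z)⁻¹ := by
  simp only [Matrix.inv_def, Ring.inverse_eq_inv']
  exact ((S.continuous_compress Λ).matrix_det.inv₀ fun z => (hΛ z).det_pos.ne').smul
    (S.continuous_compress Λ).matrix_adjugate

theorem continuous_pair_omegaTilde (ψ : C(Circle, ℝ)) {Λ : S.imGam} (hΛ : Λ ∈ S.LplusGam)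
    (Λ' : HermMat n) :
    Continuous fun z => ψ z * (S.compress Λ' z * (S.compress Λ z)⁻¹).trace.re :=
  ψ.continuous.mul (continuous_trace_re (S.continuous_compress Λ') (continuous_inv_compress hΛ))

/-- The integrand contains `tr (Q Q⁻¹) = m`. Independence of `Λ` is what bounds the parameters. -/
theorem pair_self_omegaTilde (ψ : C(Circle, ℝ)) {Λ : S.imGam} (hΛ : Λ ∈ S.LplusGam) :
    HermMat.pair (Λ : HermMat n) (S.omegaTilde ψ Λ : HermMat n) =
      circleMean fun z => ψ z * m := by
  rw [pair_omegaTilde ψ hΛ]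
  refine congrArg circleMean (funext fun z => ?_)
  have hu := mul_nonsing_inv _ ((isUnit_iff_isUnit_det _).1 (compress_posDef_of_mem hΛ z).isUnit)
  rw [hu, trace_one, Fintype.card_fin,
    Complex.natCast_re]

theorem omegaTilde_mem_imPlusGam {ψ : C(Circle, ℝ)} (hψ : ∀ z, 0 < ψ z) {Λ : S.imGam}
    (hΛ : Λ ∈ S.LplusGam) : S.omegaTilde ψ Λ ∈ S.imPlusGam := by
  have h := S.Gam_posDef (Φ := S.density ψ ⟨Λ, hΛ⟩) fun z => by
    rw [toMat_density]
    exact (compress_posDef_of_mem hΛ z).inv.smul (hψ z)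
  rw [← coe_omegaTilde ψ hΛ] at h
  exact h

/-- Strict monotonicity: with `D = Q₁ - Q₂`, the identity `Q₂⁻¹ - Q₁⁻¹ = Q₁⁻¹ D Q₂⁻¹` turns the
pairing of `Λ₁ - Λ₂` with the difference of values into `∫ ψ tr (D Q₁⁻¹ D Q₂⁻¹)`. -/
theorem injOn_omegaTilde {ψ : C(Circle, ℝ)} (hψ : ∀ z, 0 < ψ z) :
    Set.InjOn (S.omegaTilde ψ) S.LplusGam := by
  intro Λ₁ h₁ Λ₂ h₂ he
  have hp1 := pair_omegaTilde ψ h₁ ((Λ₁ : HermMat n) - Λ₂)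
  have hp2 := pair_omegaTilde ψ h₂ ((Λ₁ : HermMat n) - Λ₂)
  rw [he, hp2] at hp1
  set D : HermMat n := (Λ₁ : HermMat n) - Λ₂ with hD
  have hid : ∀ z, ψ z * (S.compress D z * (S.compress Λ₂ z)⁻¹).trace.re
      - ψ z * (S.compress D z * (S.compress Λ₁ z)⁻¹).trace.re
      = ψ z * (S.compress D z * (S.compress Λ₁ z)⁻¹ * S.compress D z *
        (S.compress Λ₂ z)⁻¹).trace.re := by
    intro z
    have hu1 := nonsing_inv_mul _ ((isUnit_iff_isUnit_det _).1 (h₁ z).isUnit)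
    have hu2 := mul_nonsing_inv _ ((isUnit_iff_isUnit_det _).1 (h₂ z).isUnit)
    change (S.compress Λ₁ z)⁻¹ * S.compress Λ₁ z = 1 at hu1
    change S.compress Λ₂ z * (S.compress Λ₂ z)⁻¹ = 1 at hu2
    rw [← mul_sub, ← Complex.sub_re, ← trace_sub]
    have : S.compress D z * (S.compress Λ₁ z)⁻¹ * S.compress D z * (S.compress Λ₂ z)⁻¹
        = S.compress D z * (S.compress Λ₂ z)⁻¹ - S.compress D z * (S.compress Λ₁ z)⁻¹ := by
      conv_lhs => rw [hD, compress_sub S Λ₁ Λ₂, ← compress_sub, ← hD]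
      rw [Matrix.mul_assoc, Matrix.mul_assoc, ← Matrix.mul_sub]
      congr 1
      rw [hD, compress_sub, Matrix.sub_mul, hu2, Matrix.mul_sub, Matrix.mul_one,
        ← Matrix.mul_assoc, hu1, Matrix.one_mul]
    rw [this]
  have hc := (continuous_pair_omegaTilde ψ h₂ D).sub (continuous_pair_omegaTilde ψ h₁ D)
  have hnn : ∀ z, 0 ≤ ψ z * (S.compress D z * (S.compress Λ₂ z)⁻¹).trace.re
      - ψ z * (S.compress D z * (S.compress Λ₁ z)⁻¹).trace.re := fun z => by
    rw [hid]
    exact mul_nonneg (hψ z).le (trace_sandwich_re_nonneg (S.isHermitian_compress D z)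
      (h₁ z).inv (h₂ z).inv)
  have h0 := circleMean_sub (continuous_pair_omegaTilde ψ h₂ D) (continuous_pair_omegaTilde ψ h₁ D)
  rw [hp1, sub_self] at h0
  have hz : D = 0 := S.eq_zero_of_compress_eq_zero (S.imGam.sub_mem Λ₁.2 Λ₂.2) fun z => by
    have h3 := eq_zero_of_circleMean_eq_zero hc hnn h0 z
    change ψ z * _ - ψ z * _ = 0 at h3
    rw [hid, mul_eq_zero, or_iff_right (hψ z).ne'] at h3
    exact eq_zero_of_trace_sandwich_re (S.isHermitian_compress D z) (h₁ z).inv (h₂ z).inv h3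
  exact Subtype.ext (sub_eq_zero.1 hz)

/-- The cone of all `Λ` in the range of `Γ` with `G* Λ G ≥ 0` on the circle. -/
def psdCone (S : FilterBank n m) : Set S.imGam :=
  {Λ | ∀ z, (S.compress (Λ : HermMat n) z).PosSemidef}

theorem isClosed_psdCone : IsClosed S.psdCone := by
  simp only [psdCone, compress_posSemidef_iff, Set.ofPred_forall]
  refine isClosed_iInter fun z => isClosed_iInter fun v => isClosed_le continuous_const ?_
  exact (HermMat.quad (S.G z *ᵥ v)).continuous_of_finiteDimensional.comp continuous_subtype_val

theorem LplusGam_subset_psdCone : S.LplusGam ⊆ S.psdCone := fun _ h z => (h z).posSemidef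

/-- On the cone `G* Λ G ≥ 0` the pairing with a positive definite covariance is coercive. -/
theorem exists_pair_ge {X : S.imGam} (hX : X ∈ S.imPlusGam) :
    ∃ ε : ℝ, 0 < ε ∧ ∀ Λ ∈ S.psdCone, ε * ‖Λ‖ ≤ HermMat.pair (Λ : HermMat n) (X : HermMat n) := by
  -- The pairing is positive on this compact slice, hence bounded below by some `ε`; homogeneity
  -- extends the bound to the cone.
  have hK : IsCompact (Metric.sphere (0 : S.imGam) 1 ∩ S.psdCone) :=
    (isCompact_sphere _ _).inter_right isClosed_psdCone
  have hcont : Continuous fun Λ : S.imGam => HermMat.pair (Λ : HermMat n) (X : HermMat n) :=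
    (HermMat.pair.flip (X : HermMat n)).continuous.comp continuous_subtype_val
  obtain ⟨ε, hε, h⟩ := hK.exists_forall_le' (a := 0) hcont.continuousOn fun Λ hΛ =>
    S.pair_pos Λ.2 (fun h0 => ne_zero_of_mem_unit_sphere ⟨Λ, hΛ.1⟩ (Subtype.ext h0)) hΛ.2 X.2 hX
  refine ⟨ε, hε, fun Λ hΛ => ?_⟩
  rcases eq_or_ne Λ 0 with rfl | h0
  · simp
  have hn : 0 < ‖Λ‖ := norm_pos_iff.2 h0
  have h1 := h (‖Λ‖⁻¹ • Λ) ⟨by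
    rw [mem_sphere_zero_iff_norm, norm_smul, norm_inv, norm_norm, inv_mul_cancel₀ hn.ne'], fun z => by
    rw [Submodule.coe_smul, compress_smul]
    exact (hΛ z).smul (inv_nonneg.2 hn.le)⟩
  rw [Submodule.coe_smul, map_smul, _root_.smul_apply, smul_eq_mul,
    ← div_eq_inv_mul, le_div_iff₀ hn] at h1
  exact h1

/-- The parameters stay bounded as long as the covariances converge inside the positive cone. -/
theorem exists_norm_le_of_omegaTilde (ψ : C(Circle, ℝ)) {X : S.imGam} (hX : X ∈ S.imPlusGam) :
    ∃ R : ℝ, ∀ᶠ Y in nhds X, ∀ Λ ∈ S.LplusGam, S.omegaTilde ψ Λ = Y → ‖Λ‖ ≤ R := by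
  obtain ⟨ε, hε, h⟩ := exists_pair_ge hX
  -- Replacing `X` by a nearby `Y` costs at most half of the coercivity constant, so one bound
  -- serves a whole neighbourhood.
  have hev : ∀ᶠ Y in nhds X, ‖HermMat.pair (k := n)‖ * ‖X - Y‖ < ε / 2 := by
    have hc : Continuous fun Y => ‖HermMat.pair (k := n)‖ * ‖X - Y‖ := by fun_prop
    refine (hc.tendsto X).eventually_lt_const ?_
    simpa using half_pos hε
  refine ⟨(circleMean fun z => ψ z * m) / (ε / 2), hev.mono fun Y hY Λ hΛ he => ?_⟩
  rw [le_div_iff₀ (half_pos hε), ← pair_self_omegaTilde ψ hΛ, he]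
  have h1 := h Λ (LplusGam_subset_psdCone hΛ)
  have h2 : HermMat.pair (Λ : HermMat n) ((X : HermMat n) - Y) ≤ ε / 2 * ‖Λ‖ := by
    refine (le_abs_self _).trans ((HermMat.pair.le_opNorm₂ _ _).trans ?_)
    have : ‖(X : HermMat n) - Y‖ = ‖X - Y‖ := rfl
    have h' : ‖(Λ : HermMat n)‖ = ‖Λ‖ := rfl
    rw [this, h', mul_right_comm]
    gcongr
  rw [map_sub] at h2
  linarith

end FilterBank

end SpectralEstimation

/-! ### Openness of the cones and the logarithmic divergence. -/

namespace SpectralEstimation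

open Matrix

theorem isOpen_forall_pos {X Y : Type*} [TopologicalSpace X] [TopologicalSpace Y] {K : Set Y}
    (hK : IsCompact K) {f : X × Y → ℝ} (hf : Continuous f) :
    IsOpen {x | ∀ y ∈ K, 0 < f (x, y)} :=
  isOpen_iff_eventually.2 fun _ hx => hK.eventually_forall_of_forall_eventually fun y hy =>
    hf.continuousAt.eventually_const_lt (hx y hy)

namespace FilterBank

theorem circleMean_mul_right {E : Type*} [NormedAddCommGroup E] [NormedSpace ℝ E]
    (f : Circle → E) (w : Circle) : circleMean (fun z => f (z * w)) = circleMean f := by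
  have hp : Function.Periodic (fun θ : ℝ => f (Circle.exp θ)) (2 * Real.pi) :=
    fun θ => by simp only [Circle.exp_add, Circle.exp_two_pi, mul_one]
  have h1 := hp.intervalIntegral_add_eq (-Real.pi) (-Real.pi + Complex.arg w)
  simp only [circleMean]
  congr 1
  have h2 : ∀ θ : ℝ, f (Circle.exp θ * w) = f (Circle.exp (θ + Complex.arg w)) := fun θ => by
    rw [Circle.exp_add, Circle.exp_arg]
  simp only [h2]
  rw [intervalIntegral.integral_comp_add_right (fun θ => f (Circle.exp θ))]
  rw [show -Real.pi + 2 * Real.pi = Real.pi by ring,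
    show -Real.pi + Complex.arg w + 2 * Real.pi = Real.pi + Complex.arg w by ring] at h1
  exact h1.symm

theorem integral_inv_mul_add {C δ : ℝ} (hC : 0 < C) (hδ : 0 < δ) {b : ℝ} (hb : 0 ≤ b) :
    ∫ θ in (0 : ℝ)..b, (C * θ + δ)⁻¹ = C⁻¹ * Real.log ((C * b + δ) / δ) := by
  rw [intervalIntegral.integral_comp_mul_add (fun x => x⁻¹) hC.ne', mul_zero, zero_add,
    integral_inv_of_pos hδ (by positivity), smul_eq_mul]

theorem dist_exp_mul_le (θ : ℝ) (w : Circle) : dist (Circle.exp θ * w) w ≤ |θ| := by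
  change dist ((Circle.exp θ * w : Circle) : ℂ) (w : ℂ) ≤ |θ|
  rw [dist_eq_norm]
  have h : ((Circle.exp θ * w : Circle) : ℂ) - w = (Complex.exp (Complex.I * θ) - 1) * w := by
    rw [Circle.coe_mul, Circle.coe_exp, mul_comm (θ : ℂ), sub_mul, one_mul]
  refine (congrArg norm h).le.trans ?_
  rw [norm_mul, Circle.norm_coe, mul_one]
  exact Real.norm_exp_I_mul_ofReal_sub_one_le

/-- The function `1 / |z - w|` is not integrable on the circle, quantitatively. -/
theorem exists_le_circleMean_inv_dist {a C : ℝ} (ha : 0 < a) (hC : 0 < C) (w : Circle) (T : ℝ) :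
    ∃ δ : ℝ, 0 < δ ∧ T ≤ circleMean fun z => a / (C * dist z w + δ) := by
  have hpi := Real.pi_pos
  -- Half the circle already contributes `(a / C) log ((Cπ + δ) / δ)` before normalization by `2π`.
  -- For this `δ` the quotient is `eᵗ + 1`, and `(a / C) t = 2π T`.
  set t := 2 * Real.pi * C * T / a with ht
  set δ := C * Real.pi * Real.exp (-t) with hδ
  have hδ0 : 0 < δ := by positivity
  refine ⟨δ, hδ0, ?_⟩
  have hcont : Continuous fun z : Circle => a / (C * dist z w + δ) :=
    continuous_const.div (by fun_prop) fun z => by positivity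
  have hcont' : Continuous fun θ : ℝ => a / (C * dist (Circle.exp θ * w) w + δ) :=
    hcont.comp (Circle.exp.continuous.mul continuous_const)
  have hlog : t ≤ Real.log ((C * Real.pi + δ) / δ) := by
    rw [Real.le_log_iff_exp_le (by positivity), le_div_iff₀ hδ0, hδ]
    have : Real.exp t * Real.exp (-t) = 1 := by rw [← Real.exp_add]; simp
    nlinarith [Real.exp_pos (-t), mul_pos hC hpi]
  have h1 : a * (C⁻¹ * t) ≤ ∫ θ in (0 : ℝ)..Real.pi, a / (C * dist (Circle.exp θ * w) w + δ) := by
    calc a * (C⁻¹ * t) ≤ a * (C⁻¹ * Real.log ((C * Real.pi + δ) / δ)) := by gcongr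
      _ = ∫ θ in (0 : ℝ)..Real.pi, a * (C * θ + δ)⁻¹ := by
          rw [intervalIntegral.integral_const_mul, integral_inv_mul_add hC hδ0 hpi.le]
      _ ≤ _ := by
          refine intervalIntegral.integral_mono_on hpi.le ?_ (hcont'.intervalIntegrable _ _) ?_
          · refine ContinuousOn.intervalIntegrable ?_
            rw [Set.uIcc_of_le hpi.le]
            refine continuousOn_const.mul (ContinuousOn.inv₀ (by fun_prop) fun x hx => ?_)
            have := hx.1
            positivity
          · intro θ hθ
            have h0 := hθ.1
            rw [div_eq_mul_inv]
            have := dist_exp_mul_le θ w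
            rw [abs_of_nonneg h0] at this
            gcongr
  have h2 : (∫ θ in (0 : ℝ)..Real.pi, a / (C * dist (Circle.exp θ * w) w + δ))
      ≤ ∫ θ in (-Real.pi)..Real.pi, a / (C * dist (Circle.exp θ * w) w + δ) := by
    rw [← intervalIntegral.integral_add_adjacent_intervals
      (hcont'.intervalIntegrable (-Real.pi) 0) (hcont'.intervalIntegrable 0 Real.pi)]
    have : 0 ≤ ∫ θ in (-Real.pi)..0, a / (C * dist (Circle.exp θ * w) w + δ) :=
      intervalIntegral.integral_nonneg (by linarith) fun θ _ => by positivity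
    linarith
  rw [← circleMean_mul_right _ w, circleMean, smul_eq_mul, ← div_eq_inv_mul,
    le_div_iff₀ (by positivity)]
  refine le_trans (le_of_eq ?_) (h1.trans h2)
  rw [ht]
  field_simp

variable {n m : ℕ} (S : FilterBank n m)

theorem isOpen_setOf_compress_posDef :
    IsOpen {Λ : HermMat n | ∀ z, (S.compress Λ z).PosDef} := by
  have h := isOpen_forall_pos (X := HermMat n) (Y := Circle × (Fin m → ℂ))
    (isCompact_univ.prod (isCompact_sphere (0 : Fin m → ℂ) 1))
    (f := fun p => HermMat.quad (S.G p.2.1 *ᵥ p.2.2) p.1)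
    (HermMat.continuous_quad
      ((S.continuous_G.comp continuous_snd.fst).matrix_mulVec continuous_snd.snd) continuous_fst)
  have he : {Λ : HermMat n | ∀ z, (S.compress Λ z).PosDef} = {Λ | ∀ y ∈
      (Set.univ : Set Circle) ×ˢ Metric.sphere (0 : Fin m → ℂ) 1,
        0 < HermMat.quad (S.G y.1 *ᵥ y.2) Λ} :=
    Set.ext fun Λ => ⟨fun h y hy => (S.compress_posDef_iff Λ y.1).1 (h y.1) y.2 hy.2,
      fun h z => (S.compress_posDef_iff Λ z).2 fun v hv => h (z, v) ⟨trivial, hv⟩⟩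
  rw [he]
  exact h

theorem isOpen_LplusGam : IsOpen S.LplusGam :=
  S.isOpen_setOf_compress_posDef.preimage continuous_subtype_val

theorem isOpen_imPlusGam : IsOpen S.imPlusGam := by
  have h := isOpen_forall_pos (X := HermMat n) (isCompact_sphere (0 : Fin n → ℂ) 1)
    (f := fun p => HermMat.quad p.2 p.1) (HermMat.continuous_quad continuous_snd continuous_fst)
  have he : S.imPlusGam = ((↑) : S.imGam → HermMat n) ⁻¹'
      {X | ∀ v ∈ Metric.sphere (0 : Fin n → ℂ) 1, 0 < HermMat.quad v X} :=
    Set.ext fun X => HermMat.posDef_iff_quad_sphere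
  rw [he]
  exact h.preimage continuous_subtype_val

theorem continuous_G_mulVec (v : Fin m → ℂ) : Continuous fun z => S.G z *ᵥ v :=
  S.continuous_G.matrix_mulVec continuous_const

theorem continuous_quad_G (v : Fin m → ℂ) :
    Continuous fun p : HermMat n × Circle => HermMat.quad (S.G p.2 *ᵥ v) p.1 :=
  HermMat.continuous_quad ((S.continuous_G_mulVec v).comp continuous_snd) continuous_fst

/-- Compactness of the circle makes the estimate uniform in `z`, so it can be used under the
integral. -/
theorem eventually_quad_lt (Λ : HermMat n) (v : Fin m → ℂ) {δ : ℝ} (hδ : 0 < δ) :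
    ∀ᶠ Λ' in nhds Λ, ∀ z, HermMat.quad (S.G z *ᵥ v) Λ' < HermMat.quad (S.G z *ᵥ v) Λ + δ := by
  have h := isOpen_forall_pos (X := HermMat n) (Y := Circle) isCompact_univ
    (f := fun p => HermMat.quad (S.G p.2 *ᵥ v) Λ + δ - HermMat.quad (S.G p.2 *ᵥ v) p.1)
    ((((S.continuous_quad_G v).comp (continuous_const.prodMk continuous_snd)).add
      continuous_const).sub (S.continuous_quad_G v))
  have hΛ : Λ ∈ {Λ' : HermMat n | ∀ z ∈ (Set.univ : Set Circle),
      0 < HermMat.quad (S.G z *ᵥ v) Λ + δ - HermMat.quad (S.G z *ᵥ v) Λ'} := fun z _ => by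
    linarith
  filter_upwards [h.mem_nhds hΛ] with Λ' h' z
  have := h' z trivial
  linarith

end FilterBank

end SpectralEstimation

/-! ### Blow-up of the covariance at the boundary. -/

namespace SpectralEstimation

open Matrix

namespace FilterBank

variable {n m : ℕ} (S : FilterBank n m)

/-- The resolvent identity: it exhibits the increment of `G v` as `w - z` times a factor bounded on
the circle. -/
theorem G_mulVec_sub (z w : Circle) (v : Fin m → ℂ) :
    S.G z *ᵥ v = S.G w *ᵥ v + ((w : ℂ) - z) •
      (((z : ℂ) • (1 : Matrix (Fin n) (Fin n) ℂ) - S.A)⁻¹ *ᵥ (S.G w *ᵥ v)) := by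
  have hu := S.isUnit_det z
  have h1 := S.resolvent_mul_G w
  have hz : S.G z = ((z : ℂ) • (1 : Matrix (Fin n) (Fin n) ℂ) - S.A)⁻¹ * S.B := rfl
  have h2 : (w : ℂ) • (1 : Matrix (Fin n) (Fin n) ℂ) - S.A
      = ((z : ℂ) • (1 : Matrix (Fin n) (Fin n) ℂ) - S.A) + ((w : ℂ) - z) • 1 := by
    rw [sub_smul]; abel
  rw [hz, ← h1, h2]
  generalize (z : ℂ) • (1 : Matrix (Fin n) (Fin n) ℂ) - S.A = M at hu
  rw [Matrix.add_mul, Matrix.mul_add, ← Matrix.mul_assoc, nonsing_inv_mul _ hu, Matrix.one_mul,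
    add_mulVec, Matrix.smul_mul, Matrix.one_mul, Matrix.mul_smul, smul_mulVec, mulVec_mulVec]

/-- The bound on `c`, a difference of two points of the circle, lets the quadratic term be absorbed
into a linear one. -/
theorem quad_add_smul_le (Λ : HermMat n) (u p : Fin n → ℂ) {c : ℂ} (hc : ‖c‖ ≤ 2) :
    HermMat.quad (u + c • p) Λ ≤ HermMat.quad u Λ + ‖c‖ * (2 * |HermMat.quad p Λ|
      + ‖star u ⬝ᵥ Λ.toMat *ᵥ p‖ + ‖star p ⬝ᵥ Λ.toMat *ᵥ u‖) := by
  have h1 : HermMat.quad (u + c • p) Λ = HermMat.quad u Λ + HermMat.quad (c • p) Λ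
      + (c * (star u ⬝ᵥ Λ.toMat *ᵥ p)).re + (star c * (star p ⬝ᵥ Λ.toMat *ᵥ u)).re := by
    simp only [HermMat.quad_apply, mulVec_add, star_add, add_dotProduct, dotProduct_add,
      mulVec_smul, star_smul, smul_dotProduct, dotProduct_smul, smul_eq_mul, Complex.add_re, mul_add]
    ring
  have h2 : HermMat.quad (c • p) Λ ≤ ‖c‖ * (2 * |HermMat.quad p Λ|) := by
    rw [HermMat.quad_smul, sq, mul_assoc]
    refine mul_le_mul_of_nonneg_left ?_ (norm_nonneg c)
    exact (mul_le_mul_of_nonneg_left (le_abs_self _) (norm_nonneg c)).trans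
      (mul_le_mul_of_nonneg_right hc (abs_nonneg _))
  have h3 := (Complex.re_le_norm (c * (star u ⬝ᵥ Λ.toMat *ᵥ p))).trans (norm_mul _ _).le
  have h4 := (Complex.re_le_norm (star c * (star p ⬝ᵥ Λ.toMat *ᵥ u))).trans (norm_mul _ _).le
  rw [norm_star] at h4
  rw [h1]
  linarith

/-- Near a zero, the form `v* G* Λ G v` grows at most linearly. -/
theorem exists_quad_G_le_dist (Λ : HermMat n) (v : Fin m → ℂ) (w : Circle)
    (hw : HermMat.quad (S.G w *ᵥ v) Λ = 0) :
    ∃ C : ℝ, 0 < C ∧ ∀ z, HermMat.quad (S.G z *ᵥ v) Λ ≤ C * dist z w := by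
  set u := S.G w *ᵥ v with hu
  let p : Circle → Fin n → ℂ := fun z =>
    ((z : ℂ) • (1 : Matrix (Fin n) (Fin n) ℂ) - S.A)⁻¹ *ᵥ u
  have hA : SchurStable S.A := S.schurStable
  have hp : Continuous p := hA.continuous_resolvent.matrix_mulVec continuous_const
  have hq : Continuous fun z => HermMat.quad (p z) Λ :=
    HermMat.continuous_quad hp continuous_const
  have hcont : Continuous fun z => 2 * |HermMat.quad (p z) Λ|
      + ‖star u ⬝ᵥ Λ.toMat *ᵥ p z‖ + ‖star (p z) ⬝ᵥ Λ.toMat *ᵥ u‖ :=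
    ((continuous_const.mul hq.abs).add
      (continuous_const.dotProduct (continuous_const.matrix_mulVec hp)).norm).add
      (hp.star.dotProduct continuous_const).norm
  obtain ⟨C, hC⟩ := isCompact_univ.exists_bound_of_continuousOn hcont.continuousOn
  refine ⟨max C 1, by positivity, fun z => ?_⟩
  have hd : ‖(w : ℂ) - z‖ = dist z w := by
    rw [← dist_eq_norm, dist_comm]; rfl
  have h2 : ‖(w : ℂ) - z‖ ≤ 2 := by
    refine (norm_sub_le _ _).trans ?_
    rw [Circle.norm_coe, Circle.norm_coe]; norm_num
  have h3 := quad_add_smul_le Λ u (p z) h2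
  rw [hw, zero_add, hd] at h3
  rw [S.G_mulVec_sub z w v]
  refine h3.trans ?_
  rw [mul_comm]
  refine mul_le_mul_of_nonneg_right ?_ dist_nonneg
  exact ((le_abs_self _).trans (hC z trivial)).trans (le_max_left _ _)

/-- The trace of a Hermitian matrix. -/
def traceLin : HermMat n →ₗ[ℝ] ℝ := ∑ i, HermMat.quad (Pi.single i 1)

variable {S}

/-- Cauchy–Schwarz for `Q` and `Q⁻¹` bounds a diagonal entry of `ψ G Q⁻¹ G*` below by the reciprocal
of the form in a single direction `v`. -/
theorem norm_sq_le_quad_density (ψ : C(Circle, ℝ)) {c : ℝ} (hc : 0 ≤ c) (hψ : ∀ z, c ≤ ψ z)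
    {Λ : S.imGam} (hΛ : Λ ∈ S.LplusGam) {v : Fin m → ℂ} (hv : v ≠ 0) (z : Circle) (i : Fin n) :
    c * ‖(S.G z *ᵥ v) i‖ ^ 2 / HermMat.quad (S.G z *ᵥ v) (Λ : HermMat n) ≤
      HermMat.quad ((S.G z)ᴴ *ᵥ Pi.single i 1) (S.density ψ ⟨Λ, hΛ⟩ z) := by
  have hQ := compress_posDef_of_mem hΛ z
  have h1 := norm_sq_dotProduct_le_inv hQ ((S.G z)ᴴ *ᵥ Pi.single i 1) v
  have h2 : star ((S.G z)ᴴ *ᵥ Pi.single i (1 : ℂ)) ⬝ᵥ v = (S.G z *ᵥ v) i := by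
    rw [star_mulVec, conjTranspose_conjTranspose, ← dotProduct_mulVec, ← Pi.single_star, star_one,
      single_one_dotProduct]
  have hpos : 0 < HermMat.quad (S.G z *ᵥ v) (Λ : HermMat n) := by
    rw [← quad_compress]
    exact (Complex.lt_def.1 (hQ.dotProduct_mulVec_pos hv)).1
  rw [h2, quad_compress] at h1
  have h3 : HermMat.quad ((S.G z)ᴴ *ᵥ Pi.single i 1) (S.density ψ ⟨Λ, hΛ⟩ z)
      = ψ z * (star ((S.G z)ᴴ *ᵥ Pi.single i 1) ⬝ᵥ
        (S.compress (Λ : HermMat n) z)⁻¹ *ᵥ ((S.G z)ᴴ *ᵥ Pi.single i 1)).re := by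
    rw [HermMat.quad_apply, toMat_density, smul_mulVec, dotProduct_smul, Complex.smul_re,
      smul_eq_mul]
  rw [h3, mul_div_assoc]
  refine mul_le_mul (hψ z) ((div_le_iff₀ hpos).2 h1) (by positivity) (hc.trans (hψ z))

theorem le_traceLin_omegaTilde (ψ : C(Circle, ℝ)) {c : ℝ} (hc : 0 ≤ c) (hψ : ∀ z, c ≤ ψ z)
    {Λ : S.imGam} (hΛ : Λ ∈ S.LplusGam) {v : Fin m → ℂ} (hv : v ≠ 0) {f : Circle → ℝ}
    (hf : Continuous f)
    (hle : ∀ z, f z ≤ c * (∑ i, ‖(S.G z *ᵥ v) i‖ ^ 2) /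
      HermMat.quad (S.G z *ᵥ v) (Λ : HermMat n)) :
    circleMean f ≤ traceLin (S.omegaTilde ψ Λ : HermMat n) := by
  have hs : traceLin (S.omegaTilde ψ Λ : HermMat n) = circleMean fun z => ∑ i,
      HermMat.quad ((S.G z)ᴴ *ᵥ Pi.single i 1) (S.density ψ ⟨Λ, hΛ⟩ z) := by
    rw [coe_omegaTilde ψ hΛ, traceLin, LinearMap.sum_apply]
    simp only [quad_Gam, circleMean]
    rw [intervalIntegral.integral_finsetSum, Finset.smul_sum]
    exact fun i _ => intervalIntegrable_comp_exp (S.continuous_quad_conjTranspose_G _ _) _ _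
  rw [hs]
  refine circleMean_mono hf
    (continuous_finsetSum _ fun i _ => S.continuous_quad_conjTranspose_G _ _) fun z => ?_
  refine (hle z).trans ?_
  rw [Finset.mul_sum, Finset.sum_div]
  exact Finset.sum_le_sum fun i _ => norm_sq_le_quad_density ψ hc hψ hΛ hv z i

/-- At the boundary of `𝓛₊` the covariance blows up. -/
theorem eventually_le_traceLin {ψ : C(Circle, ℝ)} {c : ℝ} (hc : 0 < c) (hψ : ∀ z, c ≤ ψ z)
    {Λ : S.imGam} (hΛ : Λ ∈ S.psdCone) (hΛ' : Λ ∉ S.LplusGam) (T : ℝ) :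
    ∀ᶠ Λ' in nhds Λ, Λ' ∈ S.LplusGam → T ≤ traceLin (S.omegaTilde ψ Λ' : HermMat n) := by
  have hex : ∃ w, ∃ v ∈ Metric.sphere (0 : Fin m → ℂ) 1,
      HermMat.quad (S.G w *ᵥ v) (Λ : HermMat n) ≤ 0 := by
    by_contra! hcon
    exact hΛ' fun w => (S.compress_posDef_iff _ w).2 (hcon w)
  obtain ⟨w, v, hv, hq⟩ := hex
  have hv0 : v ≠ 0 := ne_zero_of_mem_unit_sphere ⟨v, hv⟩
  have hq0 := le_antisymm hq ((S.compress_posSemidef_iff _ w).1 (hΛ w) v)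
  obtain ⟨C, hC, hqC⟩ := S.exists_quad_G_le_dist Λ v w hq0
  have hGc : Continuous fun z => ∑ i, ‖(S.G z *ᵥ v) i‖ ^ 2 :=
    continuous_finsetSum _ fun i _ =>
      ((continuous_apply i).comp (S.continuous_G_mulVec v)).norm.pow 2
  have hGpos : ∀ z, 0 < ∑ i, ‖(S.G z *ᵥ v) i‖ ^ 2 := fun z => by
    have hne : S.G z *ᵥ v ≠ 0 := fun h =>
      hv0 (S.mulVec_G_injective z (h.trans (mulVec_zero _).symm))
    obtain ⟨i, hi⟩ := Function.ne_iff.1 hne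
    exact Finset.sum_pos' (fun i _ => by positivity)
      ⟨i, Finset.mem_univ i, pow_pos (norm_pos_iff.2 hi) 2⟩
  obtain ⟨a, ha, hGa⟩ := isCompact_univ.exists_forall_le' hGc.continuousOn fun z _ => hGpos z
  -- `δ` is fixed by `T` first; the neighbourhood of `Λ` is then taken so small that the form
  -- exceeds its limit by less than `δ`.
  obtain ⟨δ, hδ, hT⟩ := exists_le_circleMean_inv_dist (mul_pos hc ha) hC w T
  have hev := (continuous_subtype_val.tendsto Λ).eventually
    (S.eventually_quad_lt (Λ : HermMat n) v hδ)
  filter_upwards [hev] with Λ' h' hmem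
  refine hT.trans (le_traceLin_omegaTilde ψ hc.le hψ hmem hv0 ?_ fun z => ?_)
  · exact continuous_const.div (by fun_prop) fun z => by positivity
  · have hpos : 0 < HermMat.quad (S.G z *ᵥ v) (Λ' : HermMat n) := by
      rw [← quad_compress]
      exact (Complex.lt_def.1 ((compress_posDef_of_mem hmem z).dotProduct_mulVec_pos hv0)).1
    have h1 := hGa z trivial
    have h2 := h' z
    have h3 := hqC z
    refine div_le_div₀ (by have := hGpos z; positivity) (by gcongr) hpos (by linarith)

end FilterBank

end SpectralEstimation

/-! ### Differentiability of `ω̃` and invertibility of its differential. -/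

namespace SpectralEstimation

open Matrix

/-- The algebra of complex `k × k` matrices, normed by the Frobenius norm. -/
def MatAlg (k : ℕ) : Type := Matrix (Fin k) (Fin k) ℂ

namespace MatAlg

variable {k : ℕ}

instance : NormedRing (MatAlg k) :=
  letI : NormedRing (Matrix (Fin k) (Fin k) ℂ) := Matrix.frobeniusNormedRing
  inferInstanceAs (NormedRing (Matrix (Fin k) (Fin k) ℂ))

instance : NormedAlgebra ℝ (MatAlg k) :=
  letI : NormedRing (Matrix (Fin k) (Fin k) ℂ) := Matrix.frobeniusNormedRing
  letI : NormedAlgebra ℝ (Matrix (Fin k) (Fin k) ℂ) := Matrix.frobeniusNormedAlgebra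
  inferInstanceAs (NormedAlgebra ℝ (Matrix (Fin k) (Fin k) ℂ))

instance : FiniteDimensional ℝ (MatAlg k) :=
  inferInstanceAs (FiniteDimensional ℝ (Matrix (Fin k) (Fin k) ℂ))

instance : CompleteSpace (MatAlg k) := FiniteDimensional.complete ℝ _

/-- A continuous matrix-valued function, with values in the normed algebra of matrices. -/
def ofContinuous {f : Circle → Matrix (Fin k) (Fin k) ℂ} (hf : Continuous f) :
    C(Circle, MatAlg k) := ⟨f, hf⟩

end MatAlg

/-- The Hermitian part of a complex matrix. -/
def hermPart (k : ℕ) : MatAlg k →L[ℝ] HermMat k :=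
  LinearMap.toContinuousLinearMap (E := MatAlg k)
    (show Matrix (Fin k) (Fin k) ℂ →ₗ[ℝ] HermMat k from
    { toFun := fun M => HermMat.ofMat ((1 / 2 : ℝ) • (M + Mᴴ)) (by
        rw [IsHermitian, conjTranspose_smul, conjTranspose_add, conjTranspose_conjTranspose,
          star_trivial, add_comm])
      map_add' := fun M M' => HermMat.toMat_injective (by
        simp only [map_add, HermMat.toMat_ofMat, conjTranspose_add, smul_add]; abel)
      map_smul' := fun c M => HermMat.toMat_injective (by
        simp only [map_smul, HermMat.toMat_ofMat, conjTranspose_smul, star_trivial, ← smul_add,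
          RingHom.id_apply, smul_comm c]) })

theorem toMat_hermPart {k : ℕ} {M : Matrix (Fin k) (Fin k) ℂ} (hM : M.IsHermitian) :
    (hermPart k M).toMat = M := by
  change (1 / 2 : ℝ) • (M + Mᴴ) = M
  rw [hM.eq, ← two_smul ℝ M, smul_smul]
  norm_num

namespace FilterBank

variable {n m : ℕ} (S : FilterBank n m)

open scoped Matrix.Norms.Frobenius in
theorem exists_norm_Gam_le : ∃ K : ℝ, ∀ Φ, ‖S.Gam Φ‖ ≤ K * ‖Φ‖ := by
  obtain ⟨K, hK⟩ := isCompact_univ.exists_bound_of_continuousOn S.continuous_G.continuousOn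
  have hpi := Real.pi_pos
  refine ⟨K * K, fun Φ => ?_⟩
  have h1 : ∀ z, ‖S.momentIntegrand Φ z‖ ≤ K * K * ‖Φ‖ := fun z => by
    change ‖S.G z * (Φ z).toMat * (S.G z)ᴴ‖ ≤ _
    have hG := hK z trivial
    have hΦ : ‖(Φ z).toMat‖ ≤ ‖Φ‖ := Φ.norm_coe_le_norm z
    have hK0 : 0 ≤ K := (norm_nonneg _).trans hG
    calc _ ≤ ‖S.G z‖ * ‖(Φ z).toMat‖ * ‖(S.G z)ᴴ‖ :=
          (frobenius_norm_mul _ _).trans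
            (mul_le_mul_of_nonneg_right (frobenius_norm_mul _ _) (norm_nonneg _))
      _ ≤ K * ‖Φ‖ * K := by rw [frobenius_norm_conjTranspose]; gcongr
      _ = _ := by ring
  have h2 := intervalIntegral.norm_integral_le_of_norm_le_const (a := -Real.pi) (b := Real.pi)
    fun θ _ => h1 (Circle.exp θ)
  change ‖(2 * Real.pi)⁻¹ • ∫ θ in (-Real.pi)..Real.pi, S.momentIntegrand Φ (Circle.exp θ)‖ ≤ _
  rw [norm_smul, Real.norm_of_nonneg (by positivity), ← div_eq_inv_mul,
    div_le_iff₀ (by positivity)]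
  refine h2.trans (le_of_eq ?_)
  rw [abs_of_pos (by linarith)]
  ring

/-- The moment map as a continuous linear map onto its range. -/
def GamCLM : C(Circle, HermMat m) →L[ℝ] S.imGam :=
  S.Gam.rangeRestrict.mkContinuous S.exists_norm_Gam_le.choose S.exists_norm_Gam_le.choose_spec

theorem GamCLM_apply (Φ : C(Circle, HermMat m)) : S.GamCLM Φ = S.Gam.rangeRestrict Φ := rfl

/-- The compression as a continuous linear map into the continuous matrix functions. -/
def compressCLM : S.imGam →L[ℝ] C(Circle, MatAlg m) :=
  LinearMap.toContinuousLinearMap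
    { toFun := fun Λ => MatAlg.ofContinuous (S.continuous_compress Λ)
      map_add' := fun Λ Λ' => ContinuousMap.ext fun z => S.compress_add Λ Λ' z
      map_smul' := fun c Λ => ContinuousMap.ext fun z => S.compress_smul c Λ z }

/-- Pointwise multiplication by a scalar weight, followed by taking the Hermitian part. -/
def weightCLM (m : ℕ) (ψ : C(Circle, ℝ)) :
    C(Circle, MatAlg m) →L[ℝ] C(Circle, HermMat m) :=
  ((hermPart m).compLeftContinuous ℝ Circle).comp
    (ContinuousLinearMap.mul ℝ C(Circle, MatAlg m)
      (MatAlg.ofContinuous (f := fun z => ψ z • 1) (ψ.continuous.smul continuous_const)))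

theorem toMat_weightCLM {m : ℕ} (ψ : C(Circle, ℝ)) {M : C(Circle, MatAlg m)}
    {z : Circle} {N : Matrix (Fin m) (Fin m) ℂ} (hN : N.IsHermitian) (hM : M z = N) :
    (weightCLM m ψ M z).toMat = ψ z • N := by
  rw [← hM] at hN ⊢
  change (hermPart m ((ψ z • (1 : Matrix (Fin m) (Fin m) ℂ)) * (show Matrix (Fin m) (Fin m) ℂ from M z))).toMat = _
  rw [Matrix.smul_mul, Matrix.one_mul, toMat_hermPart]
  rw [IsHermitian, conjTranspose_smul, star_trivial, hN.eq]

/-- The density as a function of the parameter, on all of `im Γ`. -/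
def densityExt (ψ : C(Circle, ℝ)) (Λ : S.imGam) : C(Circle, HermMat m) :=
  weightCLM m ψ (Ring.inverse (S.compressCLM Λ))

variable {S}

/-- The compression of an element of `𝓛₊` as a unit of the algebra of matrix functions. -/
def compressUnit {Λ : S.imGam} (hΛ : Λ ∈ S.LplusGam) : C(Circle, MatAlg m)ˣ where
  val := S.compressCLM Λ
  inv := MatAlg.ofContinuous (continuous_inv_compress hΛ)
  val_inv := ContinuousMap.ext fun z => mul_nonsing_inv _
    ((isUnit_iff_isUnit_det _).1 (compress_posDef_of_mem hΛ z).isUnit)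
  inv_val := ContinuousMap.ext fun z => nonsing_inv_mul _
    ((isUnit_iff_isUnit_det _).1 (compress_posDef_of_mem hΛ z).isUnit)

theorem val_compressUnit {Λ : S.imGam} (hΛ : Λ ∈ S.LplusGam) :
    (compressUnit hΛ : C(Circle, MatAlg m)) = S.compressCLM Λ := rfl

theorem inv_compressUnit_apply {Λ : S.imGam} (hΛ : Λ ∈ S.LplusGam) (z : Circle) :
    (((compressUnit hΛ)⁻¹ : C(Circle, MatAlg m)ˣ) :
      C(Circle, MatAlg m)) z = (S.compress Λ z)⁻¹ := rfl

theorem densityExt_eq (ψ : C(Circle, ℝ)) {Λ : S.imGam} (hΛ : Λ ∈ S.LplusGam) :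
    S.densityExt ψ Λ = S.density ψ ⟨Λ, hΛ⟩ := by
  refine ContinuousMap.ext fun z => HermMat.toMat_injective ?_
  rw [toMat_density, densityExt, ← val_compressUnit hΛ, Ring.inverse_unit]
  exact toMat_weightCLM ψ (compress_posDef_of_mem hΛ z).inv.isHermitian
    (inv_compressUnit_apply hΛ z)

/-- Inversion is smooth at units of the Banach algebra of continuous matrix functions, and the
remaining maps are continuous linear. No differentiation under the integral is needed, and
regularity holds in the uniform norm. -/
theorem contDiffAt_densityExt (ψ : C(Circle, ℝ)) {Λ : S.imGam} (hΛ : Λ ∈ S.LplusGam) :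
    ContDiffAt ℝ 1 (S.densityExt ψ) Λ := by
  have h1 : ContDiffAt ℝ 1 (Ring.inverse (M₀ := C(Circle, MatAlg m)))
      (S.compressCLM Λ) := contDiffAt_ringInverse ℝ (compressUnit hΛ)
  exact (weightCLM m ψ).contDiff.contDiffAt.comp Λ (h1.comp Λ S.compressCLM.contDiff.contDiffAt)

theorem omegaTilde_eventuallyEq (ψ : C(Circle, ℝ)) {Λ : S.imGam} (hΛ : Λ ∈ S.LplusGam) :
    S.omegaTilde ψ =ᶠ[nhds Λ] fun Λ' => S.GamCLM (S.densityExt ψ Λ') := by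
  filter_upwards [S.isOpen_LplusGam.mem_nhds hΛ] with Λ' h'
  rw [omegaTilde, dif_pos h', densityExt_eq ψ h', GamCLM_apply]

theorem contDiffAt_omegaTilde (ψ : C(Circle, ℝ)) {Λ : S.imGam} (hΛ : Λ ∈ S.LplusGam) :
    ContDiffAt ℝ 1 (S.omegaTilde ψ) Λ :=
  (S.GamCLM.contDiff.contDiffAt.comp Λ (contDiffAt_densityExt ψ hΛ)).congr_of_eventuallyEq
    (omegaTilde_eventuallyEq ψ hΛ)

/-- The derivative of `ω̃` at `Λ` in the direction `H` is `-∫ ψ G Q⁻¹ (G* H G) Q⁻¹ G*` with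
`Q = G* Λ G`. -/
theorem fderiv_omegaTilde_apply (ψ : C(Circle, ℝ)) {Λ : S.imGam} (hΛ : Λ ∈ S.LplusGam)
    (H : S.imGam) :
    fderiv ℝ (S.omegaTilde ψ) Λ H = -S.GamCLM (weightCLM m ψ
      (((compressUnit hΛ)⁻¹ : C(Circle, MatAlg m)ˣ) * S.compressCLM H *
        ((compressUnit hΛ)⁻¹ : C(Circle, MatAlg m)ˣ))) := by
  have h1 := hasFDerivAt_ringInverse (𝕜 := ℝ) (compressUnit hΛ)
  rw [val_compressUnit] at h1
  have h2 := (S.GamCLM.comp (weightCLM m ψ)).hasFDerivAt.comp Λ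
    (h1.comp Λ S.compressCLM.hasFDerivAt)
  have h3 := (h2.congr_of_eventuallyEq (omegaTilde_eventuallyEq ψ hΛ)).fderiv
  rw [h3]
  simp only [ContinuousLinearMap.comp_apply, _root_.neg_apply, map_neg,
    ContinuousLinearMap.mulLeftRight_apply]

/-- If `H` is in the kernel, pairing the differential with `H` gives `∫ ψ tr (K Q⁻¹ K Q⁻¹) = 0` for
`K = G* H G`, which forces `K = 0`. -/
theorem injective_fderiv_omegaTilde {ψ : C(Circle, ℝ)} (hψ : ∀ z, 0 < ψ z) {Λ : S.imGam}
    (hΛ : Λ ∈ S.LplusGam) : Function.Injective (fderiv ℝ (S.omegaTilde ψ) Λ) := by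
  refine (injective_iff_map_eq_zero _).2 fun H hH => ?_
  rw [fderiv_omegaTilde_apply ψ hΛ, neg_eq_zero] at hH
  have hH' := congrArg (fun X : S.imGam => HermMat.pair (H : HermMat n) (X : HermMat n)) hH
  simp only [GamCLM_apply, LinearMap.codRestrict_apply, Submodule.coe_zero, map_zero] at hH'
  set Φ := weightCLM m ψ
      (((compressUnit hΛ)⁻¹ : C(Circle, MatAlg m)ˣ) * S.compressCLM H *
        ((compressUnit hΛ)⁻¹ : C(Circle, MatAlg m)ˣ)) with hΦ
  have hpair := S.pair_Gam H Φ
  have hval : ∀ z, (S.compress (H : HermMat n) z * (Φ z).toMat).trace.re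
      = ψ z * (S.compress (H : HermMat n) z * (S.compress (Λ : HermMat n) z)⁻¹ *
        S.compress (H : HermMat n) z * (S.compress (Λ : HermMat n) z)⁻¹).trace.re := by
    intro z
    have hherm : ((S.compress (Λ : HermMat n) z)⁻¹ * S.compress (H : HermMat n) z *
        (S.compress (Λ : HermMat n) z)⁻¹).IsHermitian := by
      rw [IsHermitian, conjTranspose_mul, conjTranspose_mul,
        (compress_posDef_of_mem hΛ z).inv.isHermitian.eq, (S.isHermitian_compress H z).eq,
        Matrix.mul_assoc]
    have hz : (Φ z).toMat = ψ z • ((S.compress (Λ : HermMat n) z)⁻¹ *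
        S.compress (H : HermMat n) z * (S.compress (Λ : HermMat n) z)⁻¹) :=
      toMat_weightCLM ψ hherm rfl
    rw [hz, Matrix.mul_smul, trace_smul, Complex.smul_re, smul_eq_mul]
    simp only [Matrix.mul_assoc]
  have hnn : ∀ z, 0 ≤ (S.compress (H : HermMat n) z * (Φ z).toMat).trace.re := fun z => by
    rw [hval]
    exact mul_nonneg (hψ z).le (trace_sandwich_re_nonneg (S.isHermitian_compress H z)
      (compress_posDef_of_mem hΛ z).inv (compress_posDef_of_mem hΛ z).inv)
  refine Subtype.ext (S.eq_zero_of_compress_eq_zero H.2 fun z => ?_)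
  have h3 := eq_zero_of_circleMean_eq_zero (S.continuous_compress_mul H Φ) hnn
    (hpair.symm.trans hH') z
  rw [hval, mul_eq_zero, or_iff_right (hψ z).ne'] at h3
  exact eq_zero_of_trace_sandwich_re (S.isHermitian_compress H z)
    (compress_posDef_of_mem hΛ z).inv (compress_posDef_of_mem hΛ z).inv h3

end FilterBank

end SpectralEstimation

/-! ### From local to global inversion. -/

namespace SpectralEstimation

open Matrix

namespace FilterBank

variable {n m : ℕ} {S : FilterBank n m}

theorem exists_equiv_hasFDerivAt_omegaTilde {ψ : C(Circle, ℝ)} (hψ : ∀ z, 0 < ψ z)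
    {Λ : S.imGam} (hΛ : Λ ∈ S.LplusGam) :
    ∃ e : S.imGam ≃L[ℝ] S.imGam, HasFDerivAt (S.omegaTilde ψ) (e : S.imGam →L[ℝ] S.imGam) Λ := by
  let e := (LinearEquiv.ofInjectiveEndo (fderiv ℝ (S.omegaTilde ψ) Λ).toLinearMap
    (injective_fderiv_omegaTilde hψ hΛ)).toContinuousLinearEquiv
  have he : (e : S.imGam →L[ℝ] S.imGam) = fderiv ℝ (S.omegaTilde ψ) Λ :=
    ContinuousLinearMap.ext fun _ => rfl
  refine ⟨e, ?_⟩
  rw [he]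
  exact ((contDiffAt_omegaTilde ψ hΛ).differentiableAt one_ne_zero).hasFDerivAt

theorem convex_imPlusGam : Convex ℝ S.imPlusGam := by
  refine convex_iff_forall_pos.2 fun X hX Y hY a b ha hb _ => ?_
  show (HermMat.toMat (a • (X : HermMat n) + b • (Y : HermMat n))).PosDef
  rw [map_add, map_smul, map_smul]
  exact (PosDef.smul hX ha).add (PosDef.smul hY hb)

theorem isOpen_image_omegaTilde {ψ : C(Circle, ℝ)} (hψ : ∀ z, 0 < ψ z) :
    IsOpen (S.omegaTilde ψ '' S.LplusGam) := by
  refine isOpen_iff_mem_nhds.2 ?_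
  rintro _ ⟨Λ, hΛ, rfl⟩
  obtain ⟨e, he⟩ := exists_equiv_hasFDerivAt_omegaTilde hψ hΛ
  have hs := (contDiffAt_omegaTilde ψ hΛ).hasStrictFDerivAt' he one_ne_zero
  rw [← hs.map_nhds_eq_of_equiv]
  exact Filter.image_mem_map (S.isOpen_LplusGam.mem_nhds hΛ)

theorem closure_image_inter_subset {ψ : C(Circle, ℝ)} {c : ℝ} (hc : 0 < c)
    (hψ : ∀ z, c ≤ ψ z) : closure (S.omegaTilde ψ '' S.LplusGam) ∩ S.imPlusGam ⊆
      S.omegaTilde ψ '' S.LplusGam := by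
  rintro Y ⟨hY, hpos⟩
  obtain ⟨y, hy, hyY⟩ := mem_closure_iff_seq_limit.1 hY
  choose Λ hΛ hΛy using hy
  obtain ⟨R, hR⟩ := exists_norm_le_of_omegaTilde ψ hpos
  have hb : ∀ᶠ k in Filter.atTop, Λ k ∈ Metric.closedBall (0 : S.imGam) R :=
    (hyY.eventually hR).mono fun k hk => mem_closedBall_zero_iff.2 (hk (Λ k) (hΛ k) (hΛy k))
  obtain ⟨L, -, φ, hφ, hlim⟩ :=
    tendsto_subseq_of_frequently_bounded Metric.isBounded_closedBall hb.frequently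
  have hyφ : Filter.Tendsto (fun k => S.omegaTilde ψ (Λ (φ k))) Filter.atTop (nhds Y) := by
    simp only [hΛy]
    exact hyY.comp hφ.tendsto_atTop
  have hpsd : L ∈ S.psdCone := isClosed_psdCone.mem_of_tendsto hlim
    (Filter.Eventually.of_forall fun k => LplusGam_subset_psdCone (hΛ (φ k)))
  -- Otherwise the traces along the subsequence would eventually be at least one more than their
  -- limit.
  have hL : L ∈ S.LplusGam := by
    by_contra hL
    have h1 := hlim.eventually
      (eventually_le_traceLin hc hψ hpsd hL (traceLin (Y : HermMat n) + 1))
    have hcont : Continuous fun X : S.imGam => traceLin (X : HermMat n) :=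
      (traceLin (n := n)).continuous_of_finiteDimensional.comp continuous_subtype_val
    have h2 := ge_of_tendsto ((hcont.tendsto Y).comp hyφ) (h1.mono fun k hk => hk (hΛ (φ k)))
    linarith
  exact ⟨L, hL, tendsto_nhds_unique
    ((contDiffAt_omegaTilde ψ hL).continuousAt.tendsto.comp hlim) hyφ⟩

/-- The image is open and relatively closed in a connected set. It meets that set, because a
positive definite `X` in `im Γ` is itself an admissible parameter and `ω̃(X)` is positive definite.
-/
theorem bijOn_omegaTilde {ψ : C(Circle, ℝ)} {c : ℝ} (hc : 0 < c) (hψ : ∀ z, c ≤ ψ z) :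
    Set.BijOn (S.omegaTilde ψ) S.LplusGam S.imPlusGam := by
  have hψ' : ∀ z, 0 < ψ z := fun z => hc.trans_le (hψ z)
  have hmaps : Set.MapsTo (S.omegaTilde ψ) S.LplusGam S.imPlusGam :=
    fun Λ hΛ => omegaTilde_mem_imPlusGam hψ' hΛ
  refine ⟨hmaps, injOn_omegaTilde hψ', fun X hX => ?_⟩
  have hX' := imPlusGam_subset_LplusGam hX
  exact (convex_imPlusGam.isPreconnected).subset_of_closure_inter_subset
    (isOpen_image_omegaTilde hψ') ⟨_, hmaps hX', Set.mem_image_of_mem _ hX'⟩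
    (closure_image_inter_subset hc hψ) hX

/-- Near each value the global inverse coincides with the local inverse of the inverse function
theorem, and so inherits its regularity. -/
theorem contDiffOn_invFunOn_omegaTilde {ψ : C(Circle, ℝ)} {c : ℝ} (hc : 0 < c)
    (hψ : ∀ z, c ≤ ψ z) :
    ContDiffOn ℝ 1 (Function.invFunOn (S.omegaTilde ψ) S.LplusGam) S.imPlusGam := by
  have hψ' : ∀ z, 0 < ψ z := fun z => hc.trans_le (hψ z)
  intro X hX
  obtain ⟨Λ, hΛ, rfl⟩ := (bijOn_omegaTilde hc hψ).surjOn hX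
  obtain ⟨e, he⟩ := exists_equiv_hasFDerivAt_omegaTilde hψ' hΛ
  have hf := contDiffAt_omegaTilde ψ hΛ
  have hleft : ∀ᶠ Λ' in nhds Λ,
      Function.invFunOn (S.omegaTilde ψ) S.LplusGam (S.omegaTilde ψ Λ') = Λ' := by
    filter_upwards [S.isOpen_LplusGam.mem_nhds hΛ] with Λ' h'
    exact (injOn_omegaTilde hψ').leftInvOn_invFunOn h'
  exact ((hf.to_localInverse he one_ne_zero).congr_of_eventuallyEq
    ((hf.hasStrictFDerivAt' he one_ne_zero).localInverse_unique hleft)).contDiffWithinAt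

end FilterBank

end SpectralEstimation

end

theorem mainTheorem2 {n m : ℕ} (S : SpectralEstimation.FilterBank n m)
    (ψ : C(Circle, ℝ)) (hψ : ∃ c : ℝ, 0 < c ∧ ∀ z : Circle, c ≤ ψ z) :
    -- the map is differentiable with nowhere-vanishing Jacobian determinant
    (∀ Λ ∈ S.LplusGam, DifferentiableAt ℝ (S.omegaTilde ψ) Λ ∧
      (fderiv ℝ (S.omegaTilde ψ) Λ).det ≠ 0) ∧
    -- it is a `C¹` diffeomorphism
    SpectralEstimation.IsC1Diffeo (S.omegaTilde ψ) S.LplusGam S.imPlusGam ∧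
    -- well-posedness: the parameter exists, is unique, and depends continuously on the data
    (∃ sol : S.imPlusGam → S.LplusGam, Continuous sol ∧
      ∀ (C : S.imPlusGam) (Λ : S.LplusGam), S.omegaTilde ψ Λ = C ↔ Λ = sol C) ∧
    -- well-posedness: the same for the spectral density in the parametric family
    (∃ dens : S.imPlusGam → C(Circle, SpectralEstimation.HermMat m), Continuous dens ∧
      ∀ (C : S.imPlusGam) (Φ : C(Circle, SpectralEstimation.HermMat m)),
        (Φ ∈ S.family ψ ∧ S.Gam Φ = (C : S.imGam)) ↔ Φ = dens C) := by
  obtain ⟨c, hc, hψ⟩ := hψ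
  have hψ' : ∀ z, 0 < ψ z := fun z => hc.trans_le (hψ z)
  have hbij := SpectralEstimation.FilterBank.bijOn_omegaTilde (S := S) hc hψ
  have hinv : Set.InvOn (Function.invFunOn (S.omegaTilde ψ) S.LplusGam) (S.omegaTilde ψ)
      S.LplusGam S.imPlusGam := hbij.invOn_invFunOn
  have hg := SpectralEstimation.FilterBank.contDiffOn_invFunOn_omegaTilde (S := S) hc hψ
  have hmem : Set.MapsTo (Function.invFunOn (S.omegaTilde ψ) S.LplusGam) S.imPlusGam
      S.LplusGam := hbij.surjOn.mapsTo_invFunOn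
  let sol : S.imPlusGam → S.LplusGam := fun C => ⟨_, hmem C.2⟩
  have hsol : Continuous sol := hg.continuousOn.domRestrict.subtype_mk _
  have hsol_iff : ∀ (C : S.imPlusGam) (Λ : S.LplusGam), S.omegaTilde ψ Λ = C ↔ Λ = sol C := by
    intro C Λ
    refine ⟨fun h => Subtype.ext ?_, fun h => ?_⟩
    · change (Λ : S.imGam) = Function.invFunOn (S.omegaTilde ψ) S.LplusGam C
      rw [← h, hinv.1 Λ.2]
    · rw [h]; exact hinv.2 C.2
  refine ⟨fun Λ hΛ => ⟨(SpectralEstimation.FilterBank.contDiffAt_omegaTilde ψ hΛ).differentiableAt one_ne_zero, ?_⟩,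
    ⟨S.isOpen_LplusGam, S.isOpen_imPlusGam, hbij,
      fun Λ hΛ => (SpectralEstimation.FilterBank.contDiffAt_omegaTilde ψ hΛ).contDiffWithinAt, _, hinv, hg⟩,
    -- `densityExt` takes no membership proof and is continuous into the uniform norm at points of
    -- `LplusGam`, where it equals `density`; continuity of the density thus follows from that of
    -- `sol`.
    ⟨sol, hsol, hsol_iff⟩, ⟨fun C => S.densityExt ψ (sol C), ?_, fun C Φ => ⟨?_, ?_⟩⟩⟩
  · intro h0
    have hlt := LinearMap.bot_lt_ker_of_det_eq_zero h0
    exact hlt.ne' (LinearMap.ker_eq_bot.2 (SpectralEstimation.FilterBank.injective_fderiv_omegaTilde hψ' hΛ))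
  · refine continuous_iff_continuousAt.2 fun C => ?_
    exact ContinuousAt.comp (g := S.densityExt ψ)
      (SpectralEstimation.FilterBank.contDiffAt_densityExt ψ (sol C).2).continuousAt
      (continuous_subtype_val.comp hsol).continuousAt
  · rintro ⟨⟨Λ, hΛ, rfl⟩, hG⟩
    have h1 : S.omegaTilde ψ Λ = C := Subtype.ext ((SpectralEstimation.FilterBank.coe_omegaTilde ψ hΛ).trans hG)
    have h2 : (⟨Λ, hΛ⟩ : S.LplusGam) = sol C := (hsol_iff C ⟨Λ, hΛ⟩).1 h1
    change _ = S.densityExt ψ (sol C)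
    rw [← SpectralEstimation.FilterBank.densityExt_eq ψ hΛ, ← h2]
  · rintro rfl
    refine ⟨⟨sol C, (sol C).2, SpectralEstimation.FilterBank.densityExt_eq ψ (sol C).2⟩, ?_⟩
    change S.Gam (S.densityExt ψ (sol C)) = _
    rw [SpectralEstimation.FilterBank.densityExt_eq ψ (sol C).2, ← SpectralEstimation.FilterBank.coe_omegaTilde ψ (sol C).2]
    exact congrArg Subtype.val ((hsol_iff C (sol C)).2 rfl)
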